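/- Fix an integer $m\ge 1$. The uniform attachment random graph $G_{n,m}$, $n\ge m$, on the vertex set $[n]=\{1,\ldots,n\}$ is defined recursively: $G_{m,m}$ is the complete graph on $[m]$, and, for $n\ge m$, $G_{n+1,m}$ is obtained from $G_{n,m}$ by adding the vertex $n+1$ and joining it to the vertices of an $m$-element subset of $[n]$ that is chosen uniformly at random, independently of the previous choices. Consider first-order formulas over graphs, built from the atomic formulas $x=y$ and $x\sim y$ (adjacency) with the connectives $\neg,\wedge,\vee,\Rightarrow,\Leftrightarrow$ and the quantifiers $\forall x,\exists x$ over vertices, where the same variable may be quantified several times; a sentence is a formula without free variables. Then $\{G_{n,m}\}$ obeys the $\mathrm{FO}^{m-2}$ convergence law: for every first-order sentence $\varphi$ in which at most $m-2$ different variables appear, the probability $\Pr(G_{n,m}\models\varphi)$ converges as $n\to\infty$. -/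

import Mathlib

open MeasureTheory Filter Topology

/-- First-order formulas over graphs, with named variables `0, 1, 2, …`. Mathlib's `BoundedFormula`
never requantifies a variable, so it has no notion of the number of different variables of a
formula; here a variable may be quantified several times, as usual in finite-variable logic. -/
inductive GraphFormula : Type
  | eq (x y : ℕ) : GraphFormula
  | adj (x y : ℕ) : GraphFormula
  | neg (φ : GraphFormula) : GraphFormula
  | conj (φ ψ : GraphFormula) : GraphFormula
  | disj (φ ψ : GraphFormula) : GraphFormula
  | imp (φ ψ : GraphFormula) : GraphFormula
  | bicond (φ ψ : GraphFormula) : GraphFormula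
  | all (x : ℕ) (φ : GraphFormula) : GraphFormula
  | ex (x : ℕ) (φ : GraphFormula) : GraphFormula

/-- The set of all variables that appear in a formula, free or bound. -/
def GraphFormula.vars : GraphFormula → Finset ℕ
  | .eq x y => {x, y}
  | .adj x y => {x, y}
  | .neg φ => φ.vars
  | .conj φ ψ => φ.vars ∪ ψ.vars
  | .disj φ ψ => φ.vars ∪ ψ.vars
  | .imp φ ψ => φ.vars ∪ ψ.vars
  | .bicond φ ψ => φ.vars ∪ ψ.vars
  | .all x φ => insert x φ.vars
  | .ex x φ => insert x φ.vars

/-- The set of variables that have a free occurrence in a formula. -/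
def GraphFormula.freeVars : GraphFormula → Finset ℕ
  | .eq x y => {x, y}
  | .adj x y => {x, y}
  | .neg φ => φ.freeVars
  | .conj φ ψ => φ.freeVars ∪ ψ.freeVars
  | .disj φ ψ => φ.freeVars ∪ ψ.freeVars
  | .imp φ ψ => φ.freeVars ∪ ψ.freeVars
  | .bicond φ ψ => φ.freeVars ∪ ψ.freeVars
  | .all x φ => φ.freeVars.erase x
  | .ex x φ => φ.freeVars.erase x

/-- A sentence is a formula without free variables. -/
def GraphFormula.IsSentence (φ : GraphFormula) : Prop := φ.freeVars = ∅

/-- Truth of a formula in the graph `G` when each variable `x` is interpreted as the vertex `v x`. -/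
def GraphFormula.Sat {V : Type*} (G : SimpleGraph V) : GraphFormula → (ℕ → V) → Prop
  | .eq x y, v => v x = v y
  | .adj x y, v => G.Adj (v x) (v y)
  | .neg φ, v => ¬ φ.Sat G v
  | .conj φ ψ, v => φ.Sat G v ∧ ψ.Sat G v
  | .disj φ ψ, v => φ.Sat G v ∨ ψ.Sat G v
  | .imp φ ψ, v => φ.Sat G v → ψ.Sat G v
  | .bicond φ ψ, v => (φ.Sat G v ↔ ψ.Sat G v)
  | .all x φ, v => ∀ a : V, φ.Sat G (Function.update v x a)
  | .ex x φ, v => ∃ a : V, φ.Sat G (Function.update v x a)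

/-- `G ⊨ φ` for a sentence `φ`, whose truth value in a nonempty graph does not depend on the
assignment. -/
def SimpleGraph.Models {V : Type*} (G : SimpleGraph V) (φ : GraphFormula) : Prop :=
  ∀ v : ℕ → V, φ.Sat G v

/-- The possible choices made by the `(k+1)`-st new vertex: `m`-element subsets of the set of the
`m + k` earlier vertices. Vertices are numbered from `0`, so that the new vertex is `m + k`. -/
def AttachmentChoice (m k : ℕ) : Type := {S : Finset (Fin (m + k)) // S.card = m}

instance (m k : ℕ) : Fintype (AttachmentChoice m k) :=
  inferInstanceAs (Fintype {S : Finset (Fin (m + k)) // S.card = m})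

instance (m k : ℕ) : Nonempty (AttachmentChoice m k) :=
  ⟨⟨Finset.univ.map (Fin.castAddEmb k), by simp⟩⟩

instance (m k : ℕ) : MeasurableSpace (AttachmentChoice m k) := ⊤

/-- The law of the sequence of choices: the choices are independent, and each is uniform. -/
noncomputable def attachmentMeasure (m : ℕ) : Measure (∀ k, AttachmentChoice m k) :=
  Measure.infinitePi fun k => (PMF.uniformOfFintype (AttachmentChoice m k)).toMeasure

/-- The edge between an earlier vertex `u` and a later vertex `v` is present: either both belong to
the initial complete graph on the vertices `0, …, m - 1`, or `v = m + k` has chosen `u`. -/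
def AttachesTo {m : ℕ} (ω : ∀ k, AttachmentChoice m k) (v u : ℕ) : Prop :=
  (u < v ∧ v < m) ∨ ∃ k, v = m + k ∧ ∃ i ∈ (ω k).1, u = (i : ℕ)

/-- The uniform attachment random graph `G_{n,m}`, on `n` vertices (meaningful for `n ≥ m`), as a
function of the choices. -/
def uniformAttachmentGraph (m n : ℕ) (ω : ∀ k, AttachmentChoice m k) : SimpleGraph (Fin n) :=
  SimpleGraph.fromRel fun v u : Fin n => AttachesTo ω v u

/-! Almost surely the truth value of the sentence is constant from some `n` on, and convergence of
the probabilities follows by convergence of indicators. All the graphs are initial segments of one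
random graph on `ℕ`, of which three almost sure properties are used: every vertex from `m` on has
`m` earlier neighbours, every vertex has infinitely many neighbours, and bounded subgraphs with more
edges than vertices do not escape to infinity (`TightBounded`). For the last one, every final
segment of a tight set sends back more edges than it has vertices. Hence a given nonempty set `S` of
at most `B` vertices is tight with probability at most a constant times `∏ v ∈ S, (v + 1) ^ (-(1 + 1
/ B))`; this is summable over all finite sets, and Borel–Cantelli applies
(`attachmentMeasure_tight_le`, `ae_tightBounded`).

The rest is deterministic. Two large initial segments are compared by the game with one pebble for
each variable, where a long initial segment `D` counts as pebbled forever. The invariant is an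
isomorphism between the closures of the pebbled sets, the closure being the union of the small tight
sets over them; its level drops with each move (`IsPosition`, `IsPosition.extend`).

A move near the closure is answered along a short walk, one fresh neighbour at a time: a neighbour
outside the closure enlarges the closure by itself only. Such neighbours exist because there are at
most `m - 2` pebbles (`exists_adj_notMem_tightClosure`): old vertices have many neighbours while
closures have bounded size, and a recent vertex with all its `m` back neighbours in the closure
would create too many edges.

A move far from the closure sees a tree-like neighbourhood or a single tight set over the new vertex
(`IsFar.tightClosure_insert`). The segment `D` is chosen so long that a small configuration found
outside it recurs arbitrarily far out (`IsRich`). More mutually distant copies than there are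
pebbles in place are prepared, so one of them is far from the closure (`exists_scattered`,
`exists_isFar`). -/

variable {V : Type*}
open Classical in
/-- The number of ordered pairs of adjacent vertices of `Z` that meet `U`, that is, twice the number
of edges inside `Z` that meet `U`. -/
noncomputable def dartCount (G : SimpleGraph V) (Z U : Finset V) : ℕ :=
  ((Z ×ˢ Z).filter fun p => G.Adj p.1 p.2 ∧ (p.1 ∈ U ∨ p.2 ∈ U)).card

/-! ### Counting the edges that meet a set -/

section DartCount

variable (G : SimpleGraph V)

theorem dartCount_mono {Z Z' U U' : Finset V} (hZ : Z ⊆ Z') (hU : U ⊆ U') :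
    dartCount G Z U ≤ dartCount G Z' U' := by
  classical
  refine Finset.card_le_card fun p hp => ?_
  simp only [Finset.mem_filter, Finset.mem_product] at hp ⊢
  exact ⟨⟨hZ hp.1.1, hZ hp.1.2⟩, hp.2.1, hp.2.2.imp (@hU _) (@hU _)⟩

theorem dartCount_empty (Z : Finset V) : dartCount G Z ∅ = 0 := by
  simp [dartCount]

/-- An edge that meets `U₂` cannot lie inside `Z₁`, so no edge is counted twice. This is how
excesses of edges add up throughout. -/
theorem dartCount_add_le [DecidableEq V] {Z₁ Z U₁ U₂ : Finset V} (hZ : Z₁ ⊆ Z)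
    (hd : Disjoint U₂ Z₁) :
    dartCount G Z₁ U₁ + dartCount G Z U₂ ≤ dartCount G Z (U₁ ∪ U₂) := by
  classical
  unfold dartCount
  rw [← Finset.card_union_of_disjoint]
  · refine Finset.card_le_card fun p hp => ?_
    simp only [Finset.mem_union, Finset.mem_filter, Finset.mem_product] at hp ⊢
    rcases hp with hp | hp
    · exact ⟨⟨hZ hp.1.1, hZ hp.1.2⟩, hp.2.1, by tauto⟩
    · exact ⟨hp.1, hp.2.1, by tauto⟩
  · rw [Finset.disjoint_left]
    intro p hp hq
    simp only [Finset.mem_filter, Finset.mem_product] at hp hq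
    rcases hq.2.2 with h | h
    · exact Finset.disjoint_left.1 hd h hp.1.1
    · exact Finset.disjoint_left.1 hd h hp.1.2

theorem dartCount_union_le [DecidableEq V] (Z U₁ U₂ : Finset V) :
    dartCount G Z (U₁ ∪ U₂) ≤ dartCount G Z U₁ + dartCount G (Z \ U₁) U₂ := by
  classical
  unfold dartCount
  refine le_trans (Finset.card_le_card fun p hp => ?_) (Finset.card_union_le _ _)
  simp only [Finset.mem_union, Finset.mem_filter, Finset.mem_product, Finset.mem_sdiff] at hp ⊢
  tauto

theorem dartCount_le_of_not_adj {Z Z' U : Finset V} (hU : U ⊆ Z')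
    (h : ∀ u ∈ U, ∀ w ∈ Z, w ∉ Z' → ¬ G.Adj u w) : dartCount G Z U ≤ dartCount G Z' U := by
  classical
  refine Finset.card_le_card fun p hp => ?_
  simp only [Finset.mem_filter, Finset.mem_product] at hp ⊢
  obtain ⟨⟨h1, h2⟩, ha, hu⟩ := hp
  refine ⟨?_, ha, hu⟩
  rcases hu with hu | hu
  · exact ⟨hU hu, by_contra fun hn => h _ hu _ h2 hn ha⟩
  · exact ⟨by_contra fun hn => h _ hu _ h1 hn ha.symm, hU hu⟩

theorem two_mul_card_le_dartCount_singleton [DecidableEq V] {Z Y : Finset V} {v : V} (hv : v ∈ Z)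
    (hY : Y ⊆ Z) (ha : ∀ w ∈ Y, G.Adj v w) : 2 * Y.card ≤ dartCount G Z {v} := by
  classical
  have hvY : v ∉ Y := fun h => G.irrefl (ha v h)
  have : (({v} : Finset V) ×ˢ Y ∪ Y ×ˢ {v}).card = 2 * Y.card := by
    rw [Finset.card_union_of_disjoint]
    · simp [two_mul]
    · rw [Finset.disjoint_left]
      rintro ⟨a, b⟩ h1 h2
      simp only [Finset.mem_product, Finset.mem_singleton] at h1 h2
      exact hvY (h1.1 ▸ h2.1)
  rw [← this]
  refine Finset.card_le_card fun p hp => ?_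
  simp only [Finset.mem_union, Finset.mem_filter, Finset.mem_product, Finset.mem_singleton] at hp ⊢
  rcases hp with ⟨h1, h2⟩ | ⟨h1, h2⟩
  · exact ⟨⟨h1 ▸ hv, hY h2⟩, h1 ▸ ha _ h2, Or.inl h1⟩
  · exact ⟨⟨hY h1, h2 ▸ hv⟩, h2 ▸ (ha _ h1).symm, Or.inr h2⟩

theorem two_le_dartCount_singleton [DecidableEq V] {Z : Finset V} {v w : V} (hv : v ∈ Z)
    (hw : w ∈ Z) (ha : G.Adj v w) : 2 ≤ dartCount G Z {v} := by
  simpa using two_mul_card_le_dartCount_singleton G (Y := {w}) hv (by simpa using hw)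
    (by simpa using ha)

open Classical in
theorem dartCount_singleton_le (Z : Finset V) (v : V) :
    dartCount G Z {v} ≤ 2 * (Z.filter (G.Adj v)).card := by
  have : dartCount G Z {v} ≤
      (({v} : Finset V) ×ˢ Z.filter (G.Adj v) ∪ Z.filter (G.Adj v) ×ˢ {v}).card := by
    refine Finset.card_le_card fun p hp => ?_
    simp only [Finset.mem_union, Finset.mem_filter, Finset.mem_product, Finset.mem_singleton]
      at hp ⊢
    obtain ⟨⟨h1, h2⟩, ha, h | h⟩ := hp
    · exact Or.inl ⟨h, h2, h ▸ ha⟩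
    · exact Or.inr ⟨⟨h1, h ▸ ha.symm⟩, h⟩
  refine this.trans ((Finset.card_union_le _ _).trans ?_)
  simp [two_mul]

open Classical in
theorem sum_degree_le_dartCount {Z U : Finset V} (hU : U ⊆ Z) :
    ∑ v ∈ U, (Z.filter (G.Adj v)).card ≤ dartCount G Z U := by
  rw [← Finset.card_sigma]
  refine Finset.card_le_card_of_injOn (fun p => (p.1, p.2)) ?_ ?_
  · rintro ⟨a, b⟩ h
    simp only [Finset.coe_sigma, Set.mem_sigma_iff, Finset.mem_coe, Finset.mem_filter,
      Finset.mem_product] at h ⊢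
    exact ⟨⟨hU h.1, h.2.1⟩, h.2.2, Or.inl h.1⟩
  · rintro ⟨a, b⟩ - ⟨c, d⟩ - h
    simp only [Prod.mk.injEq] at h
    rw [h.1, h.2]

/-- Swapping the entries is a fixed-point-free involution of the counted pairs. Parity lets the
negation of `2 * n + 2 ≤ dartCount` be read as `dartCount ≤ 2 * n`. -/
theorem even_dartCount (Z U : Finset V) : Even (dartCount G Z U) := by
  classical
  have : ((dartCount G Z U : ℕ) : ZMod 2) = 0 := by
    rw [dartCount, Finset.card_eq_sum_ones, Nat.cast_sum]
    refine Finset.sum_involution (fun p _ => (p.2, p.1)) ?_ ?_ ?_ ?_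
    · intro p _; rfl
    · rintro ⟨a, b⟩ hp - h
      simp only [Finset.mem_filter, Prod.mk.injEq] at hp h
      exact G.irrefl (h.1 ▸ hp.2.1)
    · rintro ⟨a, b⟩ hp
      simp only [Finset.mem_filter, Finset.mem_product] at hp ⊢
      exact ⟨⟨hp.1.2, hp.1.1⟩, hp.2.1.symm, hp.2.2.symm⟩
    · intro p _; rfl
  exact (ZMod.natCast_eq_zero_iff_even).1 this

theorem dartCount_image [DecidableEq V'] {G' : SimpleGraph V'} {h : V → V'}
    {Z U : Finset V} (hU : U ⊆ Z) (hinj : Set.InjOn h Z)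
    (hadj : ∀ u ∈ Z, ∀ v ∈ Z, G'.Adj (h u) (h v) ↔ G.Adj u v) :
    dartCount G' (Z.image h) (U.image h) = dartCount G Z U := by
  classical
  symm
  have hmem : ∀ a ∈ Z, (h a ∈ U.image h ↔ a ∈ U) := by
    intro a ha
    rw [Finset.mem_image]
    refine ⟨?_, fun h' => ⟨a, h', rfl⟩⟩
    rintro ⟨b, hb, hba⟩
    rwa [← hinj (hU hb) ha hba]
  refine Finset.card_bij (fun p _ => (h p.1, h p.2)) ?_ ?_ ?_
  · rintro ⟨a, b⟩ hp
    simp only [Finset.mem_filter, Finset.mem_product] at hp ⊢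
    refine ⟨⟨Finset.mem_image_of_mem _ hp.1.1, Finset.mem_image_of_mem _ hp.1.2⟩, ?_, ?_⟩
    · rw [hadj _ hp.1.1 _ hp.1.2]; exact hp.2.1
    · rw [hmem _ hp.1.1, hmem _ hp.1.2]; exact hp.2.2
  · rintro ⟨a, b⟩ hp ⟨c, d⟩ hq he
    simp only [Finset.mem_filter, Finset.mem_product, Prod.mk.injEq] at hp hq he
    rw [hinj hp.1.1 hq.1.1 he.1, hinj hp.1.2 hq.1.2 he.2]
  · rintro ⟨a, b⟩ hp
    simp only [Finset.mem_filter, Finset.mem_product, Finset.mem_image] at hp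
    obtain ⟨⟨⟨c, hc, rfl⟩, ⟨d, hd, rfl⟩⟩, ha, hm⟩ := hp
    refine ⟨(c, d), ?_, rfl⟩
    simp only [Finset.mem_filter, Finset.mem_product]
    rw [hadj _ hc _ hd] at ha
    refine ⟨⟨hc, hd⟩, ha, ?_⟩
    simpa only [← Finset.mem_image, hmem _ hc, hmem _ hd] using hm

end DartCount

/-! ### Tight sets and closures -/

/-- `S` is tight over `X` if every nonempty subset `U` of `S` meets more than `|U|` edges of the graph
induced on `S ∪ X`. -/
def Tight [DecidableEq V] (G : SimpleGraph V) (X S : Finset V) : Prop :=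
  Disjoint S X ∧ ∀ U ⊆ S, U.Nonempty → 2 * U.card + 2 ≤ dartCount G (S ∪ X) U

/-- The vertices that lie in `X` or in a set of at most `s` vertices that is tight over `X`. -/
def tightClosure [DecidableEq V] (G : SimpleGraph V) (s : ℕ) (X : Finset V) : Set V :=
  {v | v ∈ X ∨ ∃ S, Tight G X S ∧ S.card ≤ s ∧ v ∈ S}

section Tight

variable [DecidableEq V] {G : SimpleGraph V} {X Y S W : Finset V}

theorem tight_empty : Tight G X ∅ :=
  ⟨Finset.disjoint_empty_left _, fun U hU hne => by
    rw [Finset.subset_empty.1 hU] at hne; exact absurd hne (by simp)⟩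

theorem Tight.mono (h : Tight G X S) (hXY : X ⊆ Y) : Tight G Y (S \ Y) := by
  refine ⟨Finset.sdiff_disjoint, fun U hU hne => ?_⟩
  refine (h.2 U (hU.trans Finset.sdiff_subset) hne).trans (dartCount_mono G ?_ subset_rfl)
  intro v hv
  rw [Finset.sdiff_union_self_eq_union]
  exact Finset.union_subset_union subset_rfl hXY hv

/-- A subset of the union splits into its parts in `S₁` and `S₂`; the edges required by the two
parts are distinct by `dartCount_add_le`. -/
theorem Tight.union {S₁ S₂ : Finset V} (h₁ : Tight G X S₁) (h₂ : Tight G (S₁ ∪ X) S₂) :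
    Tight G X (S₁ ∪ S₂) := by
  have hd2 : Disjoint S₂ S₁ ∧ Disjoint S₂ X := Finset.disjoint_union_right.1 h₂.1
  refine ⟨Finset.disjoint_union_left.2 ⟨h₁.1, hd2.2⟩, fun U hU hne => ?_⟩
  have hUe : (U ∩ S₁) ∪ (U ∩ S₂) = U := by
    rw [← Finset.inter_union_distrib_left]; exact Finset.inter_eq_left.2 hU
  have hcard : U.card = (U ∩ S₁).card + (U ∩ S₂).card := by
    rw [← Finset.card_union_of_disjoint, hUe]
    exact hd2.1.symm.mono Finset.inter_subset_right Finset.inter_subset_right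
  have e : S₂ ∪ (S₁ ∪ X) = (S₁ ∪ S₂) ∪ X := by ext; simp; tauto
  have key := dartCount_add_le G (Z₁ := S₁ ∪ X) (Z := (S₁ ∪ S₂) ∪ X) (U₁ := U ∩ S₁) (U₂ := U ∩ S₂)
    (by intro v; simp; tauto) (h₂.1.mono_left Finset.inter_subset_right)
  rw [hUe] at key
  have a1 := h₁.2 (U ∩ S₁) Finset.inter_subset_right
  have a2 := h₂.2 (U ∩ S₂) Finset.inter_subset_right
  rw [e] at a2
  rcases (U ∩ S₁).eq_empty_or_nonempty with h0 | h0
  · rcases (U ∩ S₂).eq_empty_or_nonempty with h0' | h0'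
    · rw [h0, h0', Finset.union_empty] at hUe
      exact absurd hne (by simp [← hUe])
    · have := a2 h0'
      have : (U ∩ S₁).card = 0 := by simp [h0]
      omega
  · rcases (U ∩ S₂).eq_empty_or_nonempty with h0' | h0'
    · have := a1 h0
      have : (U ∩ S₂).card = 0 := by simp [h0']
      omega
    · have := a1 h0
      have := a2 h0'
      omega

theorem subset_tightClosure (s : ℕ) (X : Finset V) : (X : Set V) ⊆ tightClosure G s X :=
  fun _ hv => Or.inl hv

theorem Tight.subset_tightClosure {s : ℕ} (h : Tight G X S) (hs : S.card ≤ s) :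
    (S : Set V) ⊆ tightClosure G s X :=
  fun _ hv => Or.inr ⟨S, h, hs, hv⟩

/-- A tight set over a tight set gives a tight union, at the price of adding the sizes. This is why
a closure operation loses levels. -/
theorem tightClosure_absorb {R : Finset V} {s t : ℕ} (hR : Tight G X R) (ht : R.card ≤ t)
    (hY : Y ⊆ R ∪ X) : tightClosure G s Y ⊆ tightClosure G (s + t) X := by
  rintro v (hv | ⟨S, hS, hs, hv⟩)
  · rcases Finset.mem_union.1 (hY hv) with h | h
    · exact Or.inr ⟨R, hR, by omega, h⟩
    · exact Or.inl h
  · by_cases hX : v ∈ X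
    · exact Or.inl hX
    · refine Or.inr ⟨R ∪ (S \ (R ∪ X)), hR.union (hS.mono hY), ?_, ?_⟩
      · refine (Finset.card_union_le _ _).trans ?_
        have := Finset.card_le_card (Finset.sdiff_subset (s := S) (t := R ∪ X))
        omega
      · simp only [Finset.mem_union, Finset.mem_sdiff]; tauto

theorem tightClosure_mono {s t : ℕ} (hst : s ≤ t) (hY : Y ⊆ X) :
    tightClosure G s Y ⊆ tightClosure G t X := by
  have := tightClosure_absorb (G := G) (s := s) (t := t - s) (tight_empty (X := X)) (by simp)
    (Y := Y) (by simpa using hY)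
  rwa [Nat.add_sub_cancel' hst] at this

theorem tightClosure_insert_subset {s t : ℕ} {y : V} (hy : y ∈ tightClosure G t X) :
    tightClosure G s (insert y X) ⊆ tightClosure G (s + t) X := by
  rcases hy with hy | ⟨R, hR, ht, hy⟩
  · rw [Finset.insert_eq_of_mem hy]
    exact tightClosure_mono (by omega) subset_rfl
  · exact tightClosure_absorb hR ht (Finset.insert_subset (by simp [hy]) (by simp))

/-- If `W` itself is not tight, some nonempty `U ⊆ W` meets at most `|U|` edges. Deleting `U` keeps
the excess of edges of the rest, so the induction continues; it cannot end with the empty set, which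
has no excess. -/
theorem exists_tight_of_le_dartCount (hd : Disjoint W X)
    (h : 2 * W.card + 2 ≤ dartCount G (W ∪ X) W) :
    ∃ Z ⊆ W, Z.Nonempty ∧ Tight G X Z := by
  induction W using Finset.strongInduction with
  | H W ih =>
    have hne : W.Nonempty := by
      rw [Finset.nonempty_iff_ne_empty]
      rintro rfl
      rw [dartCount_empty] at h
      omega
    by_cases ht : Tight G X W
    · exact ⟨W, subset_rfl, hne, ht⟩
    · unfold Tight at ht
      push Not at ht
      obtain ⟨U, hU, hUne, hlt⟩ := ht hd
      have hss : W \ U ⊂ W := Finset.sdiff_ssubset hU hUne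
      have hc := Finset.card_sdiff_add_card_eq_card hU
      have h1 := dartCount_union_le G (W ∪ X) U (W \ U)
      rw [Finset.union_sdiff_of_subset hU] at h1
      have h2 : (W ∪ X) \ U = W \ U ∪ X := by
        ext v
        have : v ∈ X → v ∉ U := fun hx hu => Finset.disjoint_left.1 hd (hU hu) hx
        simp only [Finset.mem_sdiff, Finset.mem_union]
        tauto
      rw [h2] at h1
      obtain ⟨q, hq⟩ := even_dartCount G (W ∪ X) U
      obtain ⟨Z, hZ, hZ'⟩ := ih _ hss (hd.mono_left Finset.sdiff_subset) (by omega)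
      exact ⟨Z, hZ.trans Finset.sdiff_subset, hZ'⟩

/-- A maximal tight subset of `W`: over it, the rest of `W` has no excess of edges. -/
theorem exists_tight_kernel (hd : Disjoint W X) :
    ∃ Z ⊆ W, Tight G X Z ∧
      ∀ U ⊆ W \ Z, dartCount G (U ∪ (Z ∪ X)) U ≤ 2 * U.card := by
  classical
  obtain ⟨Z, hZ, hmax⟩ := Finset.exists_max_image (W.powerset.filter (Tight G X)) Finset.card
    ⟨∅, by simp [tight_empty]⟩
  simp only [Finset.mem_filter, Finset.mem_powerset] at hZ hmax
  refine ⟨Z, hZ.1, hZ.2, fun U hU => ?_⟩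
  by_contra hlt
  have hdU : Disjoint U (Z ∪ X) := by
    rw [Finset.disjoint_union_right]
    exact ⟨Finset.disjoint_of_subset_left hU Finset.sdiff_disjoint,
      hd.mono_left (hU.trans Finset.sdiff_subset)⟩
  obtain ⟨q, hq⟩ := even_dartCount G (U ∪ (Z ∪ X)) U
  obtain ⟨T, hT, hTne, hTt⟩ := exists_tight_of_le_dartCount (G := G) hdU (by omega)
  have h1 := hmax (Z ∪ T) ⟨Finset.union_subset hZ.1 (hT.trans (hU.trans Finset.sdiff_subset)),
    hZ.2.union hTt⟩
  rw [Finset.card_union_of_disjoint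
    ((hdU.mono_left hT).mono_right Finset.subset_union_left).symm] at h1
  have := hTne.card_pos
  omega

theorem tight_image_iff [DecidableEq V'] {G' : SimpleGraph V'} {h : V → V'}
    (hinj : Set.InjOn h ↑(S ∪ X))
    (hadj : ∀ u ∈ S ∪ X, ∀ v ∈ S ∪ X, G'.Adj (h u) (h v) ↔ G.Adj u v) :
    Tight G' (X.image h) (S.image h) ↔ Tight G X S := by
  have key : ∀ U ⊆ S, dartCount G' (S.image h ∪ X.image h) (U.image h) = dartCount G (S ∪ X) U := by
    intro U hU
    rw [← Finset.image_union]
    exact dartCount_image G (hU.trans Finset.subset_union_left) hinj hadj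
  have hcard : ∀ U ⊆ S, (U.image h).card = U.card := fun U hU =>
    Finset.card_image_of_injOn (hinj.mono (by
      intro v hv; exact Finset.mem_coe.2 (Finset.mem_union_left _ (hU hv))))
  constructor
  · rintro ⟨hd, ht⟩
    refine ⟨?_, fun U hU hne => ?_⟩
    · rw [Finset.disjoint_left] at hd ⊢
      exact fun a ha hb => hd (Finset.mem_image_of_mem h ha) (Finset.mem_image_of_mem h hb)
    · rw [← key U hU, ← hcard U hU]
      exact ht _ (Finset.image_subset_image hU) (hne.image h)
  · rintro ⟨hd, ht⟩
    refine ⟨?_, fun U' hU' hne => ?_⟩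
    · rw [Finset.disjoint_left] at hd ⊢
      intro a ha hb
      obtain ⟨u, hu, rfl⟩ := Finset.mem_image.1 ha
      obtain ⟨v, hv, hvu⟩ := Finset.mem_image.1 hb
      have := hinj (by simp [hv]) (by simp [hu]) hvu
      exact hd hu (this ▸ hv)
    · obtain ⟨U, hU, rfl⟩ := Finset.subset_image_iff.1 hU'
      rw [key U hU, hcard U hU]
      exact ht U hU (Finset.image_nonempty.1 hne)

theorem tight_singleton {y u w : V} (hy : y ∉ X) (hu : u ∈ X) (hw : w ∈ X) (huw : u ≠ w)
    (hyu : G.Adj y u) (hyw : G.Adj y w) : Tight G X {y} := by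
  refine ⟨by simpa using hy, fun U hU hne => ?_⟩
  rw [Finset.Nonempty.subset_singleton_iff hne] at hU
  subst hU
  have := two_mul_card_le_dartCount_singleton G (Z := {y} ∪ X) (Y := {u, w}) (v := y) (by simp)
    (by intro a; simp only [Finset.mem_insert, Finset.mem_singleton, Finset.mem_union]
        rintro (rfl | rfl) <;> simp [hu, hw])
    (by simp [hyu, hyw])
  rw [Finset.card_pair huw] at this
  simpa using this

end Tight

/-! ### Short walks and components -/

/-- There is a walk of length at most `r` from `a` to `b`. -/
def Near (G : SimpleGraph V) (r : ℕ) (a b : V) : Prop := ∃ w : G.Walk a b, w.length ≤ r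

section Near

variable {G : SimpleGraph V}

theorem Near.refl (r : ℕ) (a : V) : Near G r a a := ⟨.nil, by simp⟩

theorem Near.symm {r : ℕ} {a b : V} (h : Near G r a b) : Near G r b a := by
  obtain ⟨w, hw⟩ := h
  exact ⟨w.reverse, by simpa using hw⟩

theorem Near.trans {r s : ℕ} {a b c : V} (h : Near G r a b) (h' : Near G s b c) :
    Near G (r + s) a c := by
  obtain ⟨w, hw⟩ := h
  obtain ⟨w', hw'⟩ := h'
  exact ⟨w.append w', by rw [SimpleGraph.Walk.length_append]; omega⟩

theorem Near.mono {r s : ℕ} (hrs : r ≤ s) {a b : V} (h : Near G r a b) : Near G s a b := by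
  obtain ⟨w, hw⟩ := h
  exact ⟨w, hw.trans hrs⟩

theorem Near.of_adj {a b : V} (h : G.Adj a b) : Near G 1 a b := ⟨.cons h .nil, by simp⟩

theorem Near.map {G' : SimpleGraph V'} (f : G →g G') {r : ℕ} {a b : V} (h : Near G r a b) :
    Near G' r (f a) (f b) := by
  obtain ⟨w, hw⟩ := h
  exact ⟨w.map f, by simpa using hw⟩

/-- The part of `S` that is connected to `A` inside `S`. -/
theorem exists_component [DecidableEq V] (G : SimpleGraph V) (S A : Finset V) :
    ∃ Q ⊆ S, (∀ v ∈ Q, ∃ a ∈ A, Near G S.card a v) ∧ (∀ v ∈ Q, ∃ w ∈ A ∪ Q, G.Adj v w) ∧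
      ∀ u ∈ A ∪ Q, ∀ w ∈ S \ Q, ¬ G.Adj u w := by
  induction hn : S.card generalizing S A with
  | zero =>
    rw [Finset.card_eq_zero] at hn
    subst hn
    exact ⟨∅, by simp⟩
  | succ n ih =>
    by_cases h : ∃ v ∈ S, ∃ a ∈ A, G.Adj a v
    · obtain ⟨v, hv, a, ha, hav⟩ := h
      obtain ⟨Q, hQ, h1, h2, h3⟩ := ih (S.erase v) (insert v A)
        (by rw [Finset.card_erase_of_mem hv, hn]; rfl)
      have hvn : Near G (n + 1) a v := (Near.of_adj hav).mono (by omega)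
      refine ⟨insert v Q, Finset.insert_subset hv (hQ.trans (Finset.erase_subset _ _)), ?_, ?_, ?_⟩
      · intro w hw
        rcases Finset.mem_insert.1 hw with rfl | hw
        · exact ⟨a, ha, hvn⟩
        · obtain ⟨b, hb, hbw⟩ := h1 w hw
          rcases Finset.mem_insert.1 hb with rfl | hb
          · exact ⟨a, ha, ((Near.of_adj hav).trans hbw).mono (by omega)⟩
          · exact ⟨b, hb, hbw.mono (by omega)⟩
      · intro w hw
        rcases Finset.mem_insert.1 hw with rfl | hw
        · exact ⟨a, by simp [ha], hav.symm⟩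
        · obtain ⟨b, hb, hbw⟩ := h2 w hw
          exact ⟨b, by simp only [Finset.mem_union, Finset.mem_insert] at hb ⊢; tauto, hbw⟩
      · intro u hu w hw
        refine h3 u ?_ w ?_
        · simp only [Finset.mem_union, Finset.mem_insert] at hu ⊢; tauto
        · simp only [Finset.mem_sdiff, Finset.mem_insert, Finset.mem_erase] at hw ⊢; tauto
    · push Not at h
      refine ⟨∅, by simp, by simp, by simp, ?_⟩
      intro u hu w hw
      simp only [Finset.union_empty] at hu
      simp only [Finset.sdiff_empty] at hw
      exact h w hw u hu

/-- No edge joins the discarded part to `A ∪ Q`, so all the edges that make it tight already lie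
over `X`. -/
theorem Tight.sdiff_component [DecidableEq V] {A X S Q : Finset V} (h : Tight G (A ∪ X) S)
    (hQ : ∀ u ∈ A ∪ Q, ∀ w ∈ S \ Q, ¬ G.Adj u w) : Tight G X (S \ Q) := by
  refine ⟨h.1.mono Finset.sdiff_subset Finset.subset_union_right, fun U hU hne => ?_⟩
  refine (h.2 U (hU.trans Finset.sdiff_subset) hne).trans (dartCount_le_of_not_adj G ?_ ?_)
  · exact hU.trans Finset.subset_union_left
  · intro u hu w hw hw' hadj
    refine hQ w ?_ u (hU hu) hadj.symm
    simp only [Finset.mem_union, Finset.mem_sdiff] at hw hw' ⊢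
    tauto

/-- Following the walk from `a ∈ Z`, each vertex outside `Z` brings, at its first visit, the edge
from its predecessor. -/
theorem two_mul_card_support_le_dartCount [DecidableEq V] {a b : V} (p : G.Walk a b)
    (Z : Finset V) (ha : a ∈ Z) :
    2 * (p.support.toFinset \ Z).card ≤
      dartCount G (p.support.toFinset ∪ Z) (p.support.toFinset \ Z) := by
  induction p generalizing Z with
  | nil => simp [Finset.sdiff_eq_empty_iff_subset.2 (Finset.singleton_subset_iff.2 ha)]
  | @cons a c b hac p ih =>
    have hc : c ∈ p.support := p.start_mem_support
    by_cases hcZ : c ∈ Z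
    · have e1 : (SimpleGraph.Walk.cons hac p).support.toFinset \ Z = p.support.toFinset \ Z := by
        ext v
        simp only [SimpleGraph.Walk.support_cons, List.toFinset_cons, Finset.mem_sdiff,
          Finset.mem_insert]
        constructor
        · rintro ⟨rfl | h, h'⟩
          · exact absurd ha h'
          · exact ⟨h, h'⟩
        · tauto
      rw [e1]
      refine (ih Z hcZ).trans (dartCount_mono G ?_ subset_rfl)
      intro v; simp; tauto
    · have hi := ih (insert c Z) (by simp)
      have e1 : (SimpleGraph.Walk.cons hac p).support.toFinset \ Z =
          {c} ∪ (p.support.toFinset \ insert c Z) := by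
        ext v
        simp only [SimpleGraph.Walk.support_cons, List.toFinset_cons, Finset.mem_sdiff,
          Finset.mem_insert, Finset.mem_union, Finset.mem_singleton, List.mem_toFinset]
        constructor
        · rintro ⟨rfl | h, h'⟩
          · exact absurd ha h'
          · tauto
        · rintro (rfl | h)
          · exact ⟨Or.inr hc, hcZ⟩
          · tauto
      have hcard : ({c} ∪ (p.support.toFinset \ insert c Z)).card =
          1 + (p.support.toFinset \ insert c Z).card := by
        rw [Finset.card_union_of_disjoint (by simp), Finset.card_singleton]
      have h2 := two_le_dartCount_singleton G (Z := insert c Z) (v := c) (w := a) (by simp)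
        (by simp [ha]) hac.symm
      have key := dartCount_add_le G (Z₁ := insert c Z) (U₁ := {c})
        (Z := (SimpleGraph.Walk.cons hac p).support.toFinset ∪ Z)
        (U₂ := p.support.toFinset \ insert c Z)
        (by intro v; simp only [SimpleGraph.Walk.support_cons, List.toFinset_cons,
              Finset.mem_insert, Finset.mem_union, List.mem_toFinset]
            rintro (rfl | h)
            · exact Or.inl (Or.inr hc)
            · exact Or.inr h)
        Finset.sdiff_disjoint
      have hm : dartCount G (p.support.toFinset ∪ insert c Z) (p.support.toFinset \ insert c Z) ≤
          dartCount G ((SimpleGraph.Walk.cons hac p).support.toFinset ∪ Z)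
            (p.support.toFinset \ insert c Z) := by
        refine dartCount_mono G ?_ subset_rfl
        intro v
        simp only [SimpleGraph.Walk.support_cons, List.toFinset_cons,
              Finset.mem_insert, Finset.mem_union, List.mem_toFinset]
        rintro (h | rfl | h)
        · tauto
        · exact Or.inl (Or.inr hc)
        · tauto
      rw [e1, hcard]
      omega

end Near

/-! ### Positions of the pebble game -/

/-- `h` is a position of the pebble game: it is an isomorphism of the closures of `X` and `X'` that
maps `X` onto `X'`. -/
structure IsPosition {V V' : Type*} [DecidableEq V] [DecidableEq V'] (G : SimpleGraph V)
    (G' : SimpleGraph V') (s : ℕ) (X : Finset V) (X' : Finset V') (h : V → V') : Prop where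
  injOn : Set.InjOn h (tightClosure G s X)
  image_closure : h '' tightClosure G s X = tightClosure G' s X'
  adj_iff : ∀ u ∈ tightClosure G s X, ∀ v ∈ tightClosure G s X, G'.Adj (h u) (h v) ↔ G.Adj u v
  image_base : X.image h = X'

section Position

variable {V V' : Type*} [DecidableEq V] [DecidableEq V'] {G : SimpleGraph V} {G' : SimpleGraph V'}
  {s t : ℕ} {X Y : Finset V} {X' : Finset V'} {h : V → V'}

/-- Tightness of `S` over `Y` depends only on the graph induced on `S ∪ Y`. As both smaller closures
lie inside the larger ones, `h` carries tight sets to tight sets in both directions. -/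
theorem IsPosition.restrict (H : IsPosition G G' t X X' h)
    (hY : tightClosure G s Y ⊆ tightClosure G t X)
    (hY' : tightClosure G' s (Y.image h) ⊆ tightClosure G' t X') :
    IsPosition G G' s Y (Y.image h) h := by
  have hiff : ∀ S : Finset V, (S : Set V) ⊆ tightClosure G t X →
      (Tight G' (Y.image h) (S.image h) ↔ Tight G Y S) := by
    intro S hS
    have hsub : ∀ u ∈ S ∪ Y, u ∈ tightClosure G t X := by
      intro u hu
      rcases Finset.mem_union.1 hu with hu | hu
      · exact hS hu
      · exact hY (subset_tightClosure _ _ hu)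
    exact tight_image_iff (H.injOn.mono hsub)
      fun u hu v hv => H.adj_iff u (hsub u hu) v (hsub v hv)
  refine ⟨H.injOn.mono hY, ?_, fun u hu v hv => H.adj_iff u (hY hu) v (hY hv), rfl⟩
  apply Set.Subset.antisymm
  · rintro _ ⟨v, hv | ⟨S, hS, hs, hv⟩, rfl⟩
    · exact Or.inl (Finset.mem_image_of_mem h hv)
    · refine Or.inr ⟨S.image h, ?_, Finset.card_image_le.trans hs, Finset.mem_image_of_mem h hv⟩
      exact (hiff S ((hS.subset_tightClosure hs).trans hY)).2 hS
  · rintro v' (hv' | ⟨S', hS', hs, hv'⟩)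
    · obtain ⟨v, hv, rfl⟩ := Finset.mem_image.1 hv'
      exact ⟨v, Or.inl hv, rfl⟩
    · have hsub := (hS'.subset_tightClosure hs).trans hY'
      rw [← H.image_closure, Finset.subset_set_image_iff] at hsub
      obtain ⟨S, hS, rfl⟩ := hsub
      obtain ⟨v, hv, rfl⟩ := Finset.mem_image.1 hv'
      refine ⟨v, Or.inr ⟨S, (hiff S hS).1 hS', ?_, hv⟩, rfl⟩
      rwa [Finset.card_image_of_injOn (H.injOn.mono hS)] at hs

theorem IsPosition.mono (H : IsPosition G G' t X X' h) (hst : s ≤ t) :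
    IsPosition G G' s X X' h := by
  have := H.restrict (s := s) (Y := X) (tightClosure_mono hst subset_rfl)
    (by rw [H.image_base]; exact tightClosure_mono hst subset_rfl)
  rwa [H.image_base] at this

theorem IsPosition.mem_closure (H : IsPosition G G' t X X' h) {v : V}
    (hv : v ∈ tightClosure G t X) : h v ∈ tightClosure G' t X' :=
  H.image_closure ▸ Set.mem_image_of_mem h hv

theorem IsPosition.mem_closure_of_le (H : IsPosition G G' t X X' h) (hst : s ≤ t) {v : V}
    (hv : v ∈ tightClosure G s X) : h v ∈ tightClosure G' s X' :=
  (H.mono hst).mem_closure hv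

/-- A vertex of the closure can be pebbled, and the same map answers. -/
theorem IsPosition.insert_closure (H : IsPosition G G' (s + t) X X' h) {y : V}
    (hy : y ∈ tightClosure G t X) :
    IsPosition G G' s (insert y X) (insert (h y) X') h := by
  have hy' := H.mem_closure_of_le (by omega) hy
  have e : (insert y X).image h = insert (h y) X' := by rw [Finset.image_insert, H.image_base]
  have := H.restrict (s := s) (Y := insert y X) (tightClosure_insert_subset hy)
    (by rw [e]; exact tightClosure_insert_subset hy')
  rwa [e] at this

theorem IsPosition.symm [Nonempty V] (H : IsPosition G G' s X X' h) :
    ∃ g : V' → V, IsPosition G' G s X' X g ∧ ∀ v ∈ tightClosure G s X, g (h v) = v := by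
  have hl : ∀ v ∈ tightClosure G s X, Function.invFunOn h (tightClosure G s X) (h v) = v :=
    fun v hv => H.injOn.leftInvOn_invFunOn hv
  refine ⟨Function.invFunOn h (tightClosure G s X), ⟨?_, ?_, ?_, ?_⟩, hl⟩
  · rw [← H.image_closure]
    rintro _ ⟨u, hu, rfl⟩ _ ⟨v, hv, rfl⟩ e
    rw [hl u hu, hl v hv] at e
    rw [e]
  · rw [← H.image_closure, Set.image_image]
    ext v
    constructor
    · rintro ⟨u, hu, rfl⟩
      simpa only [hl u hu] using hu
    · exact fun hv => ⟨v, hv, hl v hv⟩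
  · rw [← H.image_closure]
    rintro _ ⟨u, hu, rfl⟩ _ ⟨v, hv, rfl⟩
    rw [hl u hu, hl v hv, H.adj_iff u hu v hv]
  · rw [← H.image_base, Finset.image_image]
    ext v
    simp only [Finset.mem_image, Function.comp]
    constructor
    · rintro ⟨u, hu, rfl⟩
      rwa [hl u (subset_tightClosure _ _ hu)]
    · exact fun hv => ⟨v, hv, hl v (subset_tightClosure _ _ hv)⟩

/-- Common form of the answers to new vertices: when pebbling `y` adds exactly a disjoint set `L` to
the closure, the map on the old closure is combined with a map on `L`. -/
theorem IsPosition.glue (H : IsPosition G G' s X X' h) {L : Set V} {L' : Set V'} {g : V → V'}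
    {y : V} (hL : ∀ w ∈ tightClosure G s X, w ∉ L) (hL' : ∀ w ∈ tightClosure G' s X', w ∉ L')
    (hg : Set.BijOn g L L') (hgadj : ∀ u ∈ L, ∀ v ∈ L, G'.Adj (g u) (g v) ↔ G.Adj u v)
    (hcross : ∀ w ∈ tightClosure G s X, ∀ l ∈ L, G'.Adj (h w) (g l) ↔ G.Adj w l) (hy : y ∈ L)
    (hcl : tightClosure G s (insert y X) = tightClosure G s X ∪ L)
    (hcl' : tightClosure G' s (insert (g y) X') = tightClosure G' s X' ∪ L') :
    ∃ h' : V → V', (∀ w ∈ X, h' w = h w) ∧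
      IsPosition G G' s (insert y X) (insert (h' y) X') h' := by
  classical
  have e1 : ∀ w ∈ tightClosure G s X, L.piecewise g h w = h w := fun w hw =>
    Set.piecewise_eq_of_notMem _ _ _ (hL w hw)
  have e2 : ∀ w ∈ L, L.piecewise g h w = g w := fun w hw => Set.piecewise_eq_of_mem _ _ _ hw
  have hX : ∀ w ∈ X, L.piecewise g h w = h w := fun w hw => e1 w (subset_tightClosure _ _ hw)
  refine ⟨L.piecewise g h, hX, ?_, ?_, ?_, ?_⟩
  · rw [hcl]
    rintro u (hu | hu) v (hv | hv) e
    · rw [e1 u hu, e1 v hv] at e; exact H.injOn hu hv e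
    · rw [e1 u hu, e2 v hv] at e
      exact absurd (e ▸ hg.mapsTo hv) (hL' _ (H.mem_closure hu))
    · rw [e2 u hu, e1 v hv] at e
      exact absurd (e ▸ hg.mapsTo hu) (hL' _ (H.mem_closure hv))
    · rw [e2 u hu, e2 v hv] at e; exact hg.injOn hu hv e
  · rw [hcl, e2 y hy, hcl', Set.image_union, ← H.image_closure, ← hg.image_eq,
      Set.image_congr e1, Set.image_congr e2]
  · rw [hcl]
    rintro u (hu | hu) v (hv | hv)
    · rw [e1 u hu, e1 v hv]; exact H.adj_iff u hu v hv
    · rw [e1 u hu, e2 v hv]; exact hcross u hu v hv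
    · rw [e2 u hu, e1 v hv, G'.adj_comm, G.adj_comm]; exact hcross v hv u hu
    · rw [e2 u hu, e2 v hv]; exact hgadj u hu v hv
  · rw [Finset.image_insert, ← H.image_base]
    congr 1
    exact Finset.image_congr fun w hw => hX w hw

/-- Pebbling a new neighbour `y` of `x ∈ X` that is outside the closure adds only `y` to the
closure. -/
theorem tightClosure_insert_pendant {x y : V} (hx : x ∈ X) (hxy : G.Adj x y)
    (hy : y ∉ tightClosure G (s + 1) X) :
    tightClosure G s (insert y X) = tightClosure G s X ∪ {y} := by
  have hyX : y ∉ X := fun h => hy (Or.inl h)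
  apply Set.Subset.antisymm
  · rintro v (hv | ⟨S, hS, hs, hv⟩)
    · rcases Finset.mem_insert.1 hv with rfl | hv
      · exact Or.inr rfl
      · exact Or.inl (Or.inl hv)
    · left
      have hdS := Finset.disjoint_insert_right.1 hS.1
      have hd : Disjoint (insert y S) X := Finset.disjoint_insert_left.2 ⟨hyX, hdS.2⟩
      obtain ⟨Z, hZ, hZt, hZk⟩ := exists_tight_kernel (G := G) hd
      have hZc : Z.card ≤ s + 1 := (Finset.card_le_card hZ).trans
        ((Finset.card_insert_le _ _).trans (by omega))
      have hyZ : y ∉ Z := fun h => hy (hZt.subset_tightClosure hZc h)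
      have hZS : Z ⊆ S := fun z hz => (Finset.mem_insert.1 (hZ hz)).resolve_left
        (fun e => hyZ (e ▸ hz))
      have hSZ : S \ Z = ∅ := by
        by_contra hne
        have hne := Finset.nonempty_iff_ne_empty.2 hne
        -- The set `S \ Z` has an excess of edges over the rest, and the edge `xy` pays for `y`.
        -- Hence `{y} ∪ (S \ Z)` has an excess over `Z ∪ X`, against the choice of the kernel.
        have k1 := hZk ({y} ∪ (S \ Z)) (by
          intro a
          simp only [Finset.mem_union, Finset.mem_singleton, Finset.mem_sdiff, Finset.mem_insert]
          rintro (rfl | ha) <;> tauto)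
        have k2 := two_le_dartCount_singleton G (Z := {y, x}) (v := y) (w := x) (by simp) (by simp)
          hxy.symm
        have k3 := hS.2 (S \ Z) Finset.sdiff_subset hne
        have hsub : ({y, x} : Finset V) ⊆ S ∪ insert y X := by
          intro a; simp only [Finset.mem_insert, Finset.mem_singleton, Finset.mem_union]
          rintro (rfl | rfl) <;> tauto
        have hxS : x ∉ S := fun h => Finset.disjoint_left.1 hdS.2 h hx
        have k4 := dartCount_add_le G (U₁ := {y}) (U₂ := S \ Z) hsub (by
          rw [Finset.disjoint_left]
          intro a ha; simp only [Finset.mem_insert, Finset.mem_singleton, Finset.mem_sdiff] at ha ⊢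
          rintro (rfl | rfl) <;> tauto)
        have k5 : dartCount G (S ∪ insert y X) ({y} ∪ (S \ Z)) ≤
            dartCount G (({y} ∪ (S \ Z)) ∪ (Z ∪ X)) ({y} ∪ (S \ Z)) := by
          refine dartCount_mono G ?_ subset_rfl
          intro a; simp only [Finset.mem_insert, Finset.mem_singleton, Finset.mem_union,
            Finset.mem_sdiff]
          tauto
        have k6 : ({y} ∪ (S \ Z)).card = 1 + (S \ Z).card := by
          rw [Finset.card_union_of_disjoint (by simp [hdS.1]), Finset.card_singleton]
        omega
      have : S = Z := Finset.Subset.antisymm (Finset.sdiff_eq_empty_iff_subset.1 hSZ) hZS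
      subst this
      exact Or.inr ⟨S, hZt, hs, hv⟩
  · refine Set.union_subset (tightClosure_mono le_rfl (Finset.subset_insert _ _)) ?_
    rintro _ rfl
    exact Or.inl (by simp)

/-- A vertex with two neighbours in a tight set together with its base can be added to that tight
set; at level `s + 1` this would place `y` in the closure. -/
theorem eq_of_adj_pendant {x y w : V} (hx : x ∈ X) (hxy : G.Adj x y)
    (hy : y ∉ tightClosure G (s + 1) X) (hw : w ∈ tightClosure G s X) (hwy : G.Adj w y) :
    w = x := by
  have hyX : y ∉ X := fun h => hy (Or.inl h)
  by_contra hne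
  rcases hw with hw | ⟨S, hS, hs, hw⟩
  · exact hy ((tight_singleton hyX hx hw (Ne.symm hne) hxy.symm hwy.symm).subset_tightClosure
      (by simp) (by simp))
  · have hyS : y ∉ S := fun h => hy (Or.inr ⟨S, hS, by omega, h⟩)
    have := hS.union (tight_singleton (G := G) (X := S ∪ X) (y := y) (by simp [hyX, hyS])
      (by simp [hx]) (by simp [hw]) (Ne.symm hne) hxy.symm hwy.symm)
    exact hy (this.subset_tightClosure ((Finset.card_union_le _ _).trans (by simpa using hs))
      (by simp))

/-- A neighbour in the closure is answered by `h` itself. Otherwise both closures grow by a single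
pendant vertex, so any fresh neighbour of `h x` is a valid answer. -/
theorem IsPosition.insert_adj (H : IsPosition G G' (2 * s + 1) X X' h) {x y : V} (hx : x ∈ X)
    (hxy : G.Adj x y)
    (hfresh : ∃ y', G'.Adj (h x) y' ∧ y' ∉ tightClosure G' (s + 1) X') :
    ∃ h' : V → V', (∀ w ∈ X, h' w = h w) ∧
      IsPosition G G' s (insert y X) (insert (h' y) X') h' := by
  by_cases hy : y ∈ tightClosure G (s + 1) X
  · exact ⟨h, fun _ _ => rfl, IsPosition.insert_closure
      (by rwa [show s + (s + 1) = 2 * s + 1 by ring]) hy⟩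
  · obtain ⟨y', hxy', hy'⟩ := hfresh
    have Hs := H.mono (show s ≤ 2 * s + 1 by omega)
    have hx' : h x ∈ X' := H.image_base ▸ Finset.mem_image_of_mem h hx
    refine Hs.glue (L := {y}) (L' := {y'}) (g := fun _ => y') ?_ ?_ ?_ ?_ ?_ rfl
      (tightClosure_insert_pendant hx hxy hy) (tightClosure_insert_pendant hx' hxy' hy')
    · rintro w hw rfl
      exact hy (tightClosure_mono (by omega) subset_rfl hw)
    · rintro w hw rfl
      exact hy' (tightClosure_mono (by omega) subset_rfl hw)
    · simp
    · rintro _ rfl _ rfl; simp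
    · rintro w hw _ rfl
      constructor
      · intro ha
        have := eq_of_adj_pendant hx' hxy' hy' (Hs.mem_closure hw) ha
        rw [Hs.injOn hw (subset_tightClosure _ _ hx) this]
        exact hxy
      · intro ha
        rw [eq_of_adj_pendant hx hxy hy hw ha]
        exact hxy'

end Position

/-! ### Homogeneous graphs and vertices far from the closure -/

/-- The level needed to answer a walk of `d` steps and end at level `s`. -/
def walkLevel : ℕ → ℕ → ℕ
  | 0, s => s
  | d + 1, s => 2 * walkLevel d s + 1

theorem le_walkLevel (d s : ℕ) : s ≤ walkLevel d s := by
  induction d with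
  | zero => exact le_rfl
  | succ d ih => simp only [walkLevel]; omega

/-- The vertex `y` is far from the closure of `X`. -/
def IsFar {V : Type*} [DecidableEq V] (G : SimpleGraph V) (s : ℕ) (X : Finset V) (y : V) : Prop :=
  ∀ x ∈ tightClosure G (2 * s + 1) X, ¬ Near G (s + 1) x y

/-- The properties of a graph `G` with distinguished set of vertices `D` that allow to answer the
moves of the game with `k` pebbles, up to level `K`. The types of the graphs on `Fin (c + 1)`
that satisfy `R` occur far from every position. -/
structure IsHomogeneous {V : Type*} [DecidableEq V] (G : SimpleGraph V) (D : Finset V) (k K : ℕ)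
    (R : ∀ c : ℕ, SimpleGraph (Fin (c + 1)) → Prop) : Prop where
  exists_fresh : ∀ X, D ⊆ X → (X \ D).card ≤ k → ∀ x ∈ X,
    ∃ y, G.Adj x y ∧ y ∉ tightClosure G K X
  rich_of_embedding : ∀ c ≤ K, ∀ (τ : SimpleGraph (Fin (c + 1))) (e : τ ↪g G),
    (∀ i, e i ∉ D) → R c τ
  exists_embedding : ∀ s ≤ K, ∀ c ≤ s, ∀ τ : SimpleGraph (Fin (c + 1)), R c τ →
    1 ≤ c → Tight τ {0} (Finset.univ.erase 0) → ∀ X, D ⊆ X → (X \ D).card + 1 ≤ k →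
      ∃ e : τ ↪g G, (∀ i, Near G s (e 0) (e i)) ∧ IsFar G s X (e 0)
  exists_treelike : ∀ s ≤ K, ∀ X, D ⊆ X → (X \ D).card + 1 ≤ k →
    ∃ y, IsFar G s X y ∧
      ∀ S, Tight G {y} S → S.card ≤ s → (∀ v ∈ S, Near G s y v) → S = ∅

section Far

variable {V V' : Type*} [DecidableEq V] [DecidableEq V'] {G : SimpleGraph V} {G' : SimpleGraph V'}
  {s t : ℕ} {X Y : Finset V} {X' : Finset V'} {h : V → V'}

theorem IsFar.not_mem {y v : V} (hf : IsFar G s X y) (hv : Near G s y v) :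
    v ∉ tightClosure G (2 * s + 1) X := fun hm => hf v hm (hv.symm.mono (by omega))

theorem IsFar.not_adj {y v w : V} (hf : IsFar G s X y) (hv : Near G s y v)
    (hw : w ∈ tightClosure G (2 * s + 1) X) : ¬ G.Adj w v := fun ha =>
  hf w hw (((Near.of_adj ha).trans hv.symm).mono (by omega))

/-- In the part of the graph that is far from the closure of `X`, at most one set is tight over
`{y}`. -/
theorem IsFar.tightClosure_insert {y : V} (hf : IsFar G s X y) {S₀ : Finset V}
    (ht : Tight G {y} S₀) (hc : S₀.card ≤ s) (hn : ∀ v ∈ S₀, Near G s y v)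
    (h0 : S₀ = ∅ → ∀ S, Tight G {y} S → S.card ≤ s → (∀ v ∈ S, Near G s y v) → S = ∅) :
    tightClosure G s (insert y X) = tightClosure G s X ∪ ↑(insert y S₀) := by
  apply Set.Subset.antisymm
  · rintro v (hv | ⟨S, hS, hs, hv⟩)
    · rcases Finset.mem_insert.1 hv with rfl | hv
      · exact Or.inr (by simp)
      · exact Or.inl (Or.inl hv)
    · obtain ⟨Q, hQ, hQ1, -, hQ3⟩ := exists_component G S {y}
      have hS' : Tight G ({y} ∪ X) S := hS
      have hSQ := hS'.sdiff_component hQ3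
      by_cases hvQ : v ∈ Q
      · right
        have hQn : ∀ v ∈ Q, Near G s y v := by
          intro w hw
          obtain ⟨a, ha, haw⟩ := hQ1 w hw
          rw [Finset.mem_singleton.1 ha] at haw
          exact haw.mono hs
        have hQt : Tight G {y} Q := by
          refine ⟨hS'.1.mono hQ Finset.subset_union_left, fun U hU hne => ?_⟩
          refine (hS'.2 U (hU.trans hQ) hne).trans (dartCount_le_of_not_adj G ?_ ?_)
          · exact hU.trans Finset.subset_union_left
          · intro u hu w hw hw' hadj
            simp only [Finset.mem_union, Finset.mem_singleton, not_or] at hw hw'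
            rcases hw with hw | hw | hw
            · exact hQ3 u (Finset.mem_union_right _ (hU hu)) w (by simp [hw, hw'.1]) hadj
            · exact hw'.2 hw
            · exact hf.not_adj (hQn u (hU hu)) (Or.inl hw) hadj.symm
        have hQs : Q.card ≤ s := (Finset.card_le_card hQ).trans hs
        have hsub : Q ⊆ S₀ := by
          rcases S₀.eq_empty_or_nonempty with he | hne
          · rw [h0 he Q hQt hQs hQn]; simp
          · by_contra hnot
            have hQne : (Q \ S₀).Nonempty := by
              rwa [Finset.nonempty_iff_ne_empty, Ne, Finset.sdiff_eq_empty_iff_subset]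
            have k1 := ht.2 S₀ subset_rfl hne
            have k2 := (hQt.mono (Y := S₀ ∪ {y}) Finset.subset_union_right).2 _ subset_rfl (by
              rw [Finset.nonempty_iff_ne_empty, Ne, Finset.sdiff_eq_empty_iff_subset]
              intro hsub
              apply hnot
              intro a ha
              rcases Finset.mem_union.1 (hsub ha) with h | h
              · exact h
              · exact absurd h (Finset.disjoint_left.1 hQt.1 ha))
            set P := Q \ (S₀ ∪ {y}) with hP
            have k3 := dartCount_add_le G (Z₁ := S₀ ∪ {y}) (Z := P ∪ (S₀ ∪ {y})) (U₁ := S₀)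
              (U₂ := P) Finset.subset_union_right Finset.sdiff_disjoint
            have hyn : y ∉ S₀ ∪ P := by
              simp only [hP, Finset.mem_union, Finset.mem_sdiff, Finset.mem_singleton]
              have := Finset.disjoint_singleton_right.1 ht.1
              tauto
            have hcard : (insert y (S₀ ∪ P)).card = 1 + S₀.card + P.card := by
              rw [Finset.card_insert_of_notMem hyn, Finset.card_union_of_disjoint]
              · omega
              · exact ((Finset.sdiff_disjoint (s := S₀ ∪ {y}) (t := Q)).mono_right
                  Finset.subset_union_left).symm
            have k4 : dartCount G (P ∪ (S₀ ∪ {y})) (S₀ ∪ P) ≤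
                dartCount G (insert y (S₀ ∪ P) ∪ ∅) (insert y (S₀ ∪ P)) := by
              refine dartCount_mono G ?_ (Finset.subset_insert _ _)
              intro a; simp only [Finset.mem_union, Finset.mem_insert, Finset.mem_singleton]; tauto
            -- The excesses of `S₀` and of `P` cover the vertex `y` and leave an excess of one edge.
            -- So `{y} ∪ S₀ ∪ P` contains a nonempty set tight over `∅`. It has at most `2 * s + 1`
            -- vertices, hence lies in the closure of `X` and yet near `y`.
            obtain ⟨Z, hZ, ⟨z, hz⟩, hZt⟩ := exists_tight_of_le_dartCount (G := G) (X := ∅)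
              (W := insert y (S₀ ∪ P)) (Finset.disjoint_empty_right _) (by omega)
            have hPc : P.card ≤ s := (Finset.card_le_card Finset.sdiff_subset).trans hQs
            have hzc : z ∈ tightClosure G (2 * s + 1) X :=
              tightClosure_mono le_rfl (Finset.empty_subset _)
                (hZt.subset_tightClosure ((Finset.card_le_card hZ).trans (by omega)) hz)
            refine hf.not_mem ?_ hzc
            have hz' := hZ hz
            simp only [hP, Finset.mem_insert, Finset.mem_union, Finset.mem_sdiff] at hz'
            rcases hz' with rfl | h | h
            · exact Near.refl _ _
            · exact hn _ h
            · exact hQn _ h.1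
        exact Finset.mem_coe.2 (Finset.mem_insert_of_mem (hsub hvQ))
      · left
        exact Or.inr ⟨S \ Q, hSQ, (Finset.card_le_card Finset.sdiff_subset).trans hs, by
          simp [hv, hvQ]⟩
  · refine Set.union_subset (tightClosure_mono le_rfl (Finset.subset_insert _ _)) ?_
    intro v hv
    rcases Finset.mem_insert.1 (Finset.mem_coe.1 hv) with rfl | hv
    · exact Or.inl (by simp)
    · refine Or.inr ⟨S₀ \ insert y X, ht.mono (by simp),
        (Finset.card_le_card Finset.sdiff_subset).trans hc, ?_⟩
      simp only [Finset.mem_sdiff, Finset.mem_insert, not_or]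
      refine ⟨hv, ?_, fun hX => hf.not_mem (hn v hv) (Or.inl hX)⟩
      rintro he
      exact Finset.disjoint_singleton_right.1 ht.1 (he ▸ hv)

/-- The set `S₀` is the only local contribution to the closure, and no edge joins it or `y` to the
old closure, on either side. Tightness of the image of `S₀` need not be assumed, since `g` is an
isomorphism there. -/
theorem IsPosition.insert_far (H : IsPosition G G' s X X' h) {y : V} {S₀ : Finset V} {g : V → V'}
    (hf : IsFar G s X y) (ht : Tight G {y} S₀) (hc : S₀.card ≤ s) (hn : ∀ v ∈ S₀, Near G s y v)
    (h0 : S₀ = ∅ → ∀ S, Tight G {y} S → S.card ≤ s → (∀ v ∈ S, Near G s y v) → S = ∅)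
    (hf' : IsFar G' s X' (g y)) (hn' : ∀ v ∈ S₀, Near G' s (g y) (g v))
    (h0' : S₀ = ∅ →
      ∀ S, Tight G' {g y} S → S.card ≤ s → (∀ v ∈ S, Near G' s (g y) v) → S = ∅)
    (hginj : Set.InjOn g ↑(insert y S₀))
    (hgadj : ∀ u ∈ insert y S₀, ∀ v ∈ insert y S₀, G'.Adj (g u) (g v) ↔ G.Adj u v) :
    ∃ h' : V → V', (∀ w ∈ X, h' w = h w) ∧
      IsPosition G G' s (insert y X) (insert (h' y) X') h' := by
  have e1 : S₀ ∪ {y} = insert y S₀ := by rw [Finset.union_comm]; rfl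
  have ht' : Tight G' {g y} (S₀.image g) := by
    have := (tight_image_iff (G' := G') (h := g) (S := S₀) (X := {y}) (G := G)
      (by rwa [e1]) (by rwa [e1])).2 ht
    simpa using this
  have hcl := hf.tightClosure_insert ht hc hn h0
  have hcl' := hf'.tightClosure_insert ht' (Finset.card_image_le.trans hc) (by simpa using hn')
    (by simpa using h0')
  have hle : tightClosure G s X ⊆ tightClosure G (2 * s + 1) X :=
    tightClosure_mono (by omega) subset_rfl
  have hle' : tightClosure G' s X' ⊆ tightClosure G' (2 * s + 1) X' :=
    tightClosure_mono (by omega) subset_rfl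
  have hnear : ∀ v ∈ insert y S₀, Near G s y v := by
    intro v hv
    rcases Finset.mem_insert.1 hv with rfl | hv
    · exact Near.refl _ _
    · exact hn v hv
  have hnear' : ∀ v ∈ insert y S₀, Near G' s (g y) (g v) := by
    intro v hv
    rcases Finset.mem_insert.1 hv with rfl | hv
    · exact Near.refl _ _
    · exact hn' v hv
  rw [← Finset.image_insert] at hcl'
  refine H.glue (L := ↑(insert y S₀)) (L' := ↑((insert y S₀).image g)) ?_ ?_ ?_ hgadj ?_
    (by simp) hcl hcl'
  · exact fun w hw hwL => hf.not_mem (hnear w hwL) (hle hw)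
  · intro w hw hwL
    obtain ⟨v, hv, rfl⟩ := Finset.mem_image.1 hwL
    exact hf'.not_mem (hnear' v hv) (hle' hw)
  · rw [Finset.coe_image]
    exact hginj.bijOn_image
  · intro w hw l hl
    exact iff_of_false (hf'.not_adj (hnear' l hl) (hle' (H.mem_closure hw)))
      (hf.not_adj (hnear l hl) (hle hw))

end Far

/-! ### Answering the moves of the game -/

section Game

variable {V V' : Type*} [DecidableEq V] [DecidableEq V'] {G : SimpleGraph V} {G' : SimpleGraph V'}
  {D : Finset V} {D' : Finset V'} {k K : ℕ} {R : ∀ c : ℕ, SimpleGraph (Fin (c + 1)) → Prop}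

/-- An auxiliary pebble is moved along the walk; `X` holds only the other pebbles. There are at most
`k` pebbles outside `D'` whenever a fresh neighbour is requested. -/
theorem IsPosition.insert_walk (hG' : IsHomogeneous G' D' k K R) {X : Finset V} {X' : Finset V'}
    (hD' : D' ⊆ X') (hk : (X' \ D').card + 1 ≤ k) {s d : ℕ} (hK : walkLevel d s ≤ K) {x y : V}
    (p : G.Walk x y) (hp : p.length ≤ d) {h : V → V'} (hX : X.image h = X')
    (H : IsPosition G G' (walkLevel d s) (insert x X) (insert (h x) X') h) :
    ∃ h' : V → V', (∀ w ∈ X, h' w = h w) ∧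
      IsPosition G G' s (insert y X) (insert (h' y) X') h' := by
  induction p generalizing d h with
  | nil => exact ⟨h, fun _ _ => rfl, H.mono (le_walkLevel _ _)⟩
  | @cons x z y hxz p ih =>
    obtain ⟨d, rfl⟩ : ∃ e, d = e + 1 := ⟨d - 1, by simp at hp; omega⟩
    simp only [SimpleGraph.Walk.length_cons, add_le_add_iff_right] at hp
    simp only [walkLevel] at hK H
    obtain ⟨y', hy', hy'n⟩ := hG'.exists_fresh (insert (h x) X')
      (hD'.trans (Finset.subset_insert _ _)) (by
        refine le_trans (Finset.card_le_card (t := insert (h x) (X' \ D')) ?_)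
          ((Finset.card_insert_le _ _).trans hk)
        intro v; simp only [Finset.mem_sdiff, Finset.mem_insert]; tauto) (h x) (by simp)
    obtain ⟨h₁, he, H₁⟩ := H.insert_adj (by simp) hxz
      ⟨y', hy', fun hm => hy'n (tightClosure_mono (by omega) subset_rfl hm)⟩
    have heX : ∀ w ∈ X, h₁ w = h w := fun w hw => he w (by simp [hw])
    have hX₁ : X.image h₁ = X' := by rw [← hX]; exact Finset.image_congr heX
    have e : (insert z X).image h₁ = insert (h₁ z) X' := by rw [Finset.image_insert, hX₁]
    -- The auxiliary pebble leaves `x` once `z` is answered, so that the number of pebbles does not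
    -- grow with the length of the walk.
    have H₂ := H₁.restrict (s := walkLevel d s) (Y := insert z X)
      (tightClosure_mono le_rfl (Finset.insert_subset_insert _ (Finset.subset_insert _ _)))
      (by rw [e]; exact tightClosure_mono le_rfl
            (Finset.insert_subset_insert _ (Finset.subset_insert _ _)))
    rw [e] at H₂
    obtain ⟨h₂, he₂, H₃⟩ := ih (by omega) hp hX₁ H₂
    exact ⟨h₂, fun w hw => (he₂ w hw).trans (heX w hw), H₃⟩

/-- The level needed before a move so that one has level `s` after it. -/
def moveLevel (s : ℕ) : ℕ := walkLevel (s + 1) s + (2 * s + 1)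

theorem le_moveLevel (s : ℕ) : s ≤ moveLevel s := (le_walkLevel (s + 1) s).trans (by
  simp [moveLevel])

/-- A far vertex is answered by a far copy of its tight set, or by a tree-like vertex if it has
none. Otherwise a walk of at most `s + 1` steps joins it to a closure vertex; pebbling that vertex
first costs the summand `2 * s + 1` of `moveLevel`. -/
theorem IsPosition.extend (hG : IsHomogeneous G D k K R) (hG' : IsHomogeneous G' D' k K R)
    {X : Finset V} {X' : Finset V'} (hD : D ⊆ X) (hD' : D' ⊆ X')
    (hk' : (X' \ D').card + 1 ≤ k) {s : ℕ} (hK : moveLevel s ≤ K) {h : V → V'}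
    (H : IsPosition G G' (moveLevel s) X X' h) (y : V) :
    ∃ h' : V → V', (∀ w ∈ X, h' w = h w) ∧
      IsPosition G G' s (insert y X) (insert (h' y) X') h' := by
  have hsK : s ≤ K := (le_moveLevel s).trans hK
  by_cases hf : IsFar G s X y
  · have Hs := H.mono (le_moveLevel s)
    by_cases h0 : ∀ S, Tight G {y} S → S.card ≤ s → (∀ v ∈ S, Near G s y v) → S = ∅
    · obtain ⟨y', hf', h0'⟩ := hG'.exists_treelike s hsK X' hD' hk'
      exact Hs.insert_far (S₀ := ∅) (g := fun _ => y') hf tight_empty (by simp) (by simp)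
        (fun _ => h0) hf' (by simp) (fun _ => h0') (by simp) (by simp)
    · push Not at h0
      obtain ⟨S, hS, hs, hn, hne⟩ := h0
      have hyS : y ∉ S := Finset.disjoint_singleton_right.1 hS.1
      have hcard : Fintype.card {v // v ∈ insert y S} = Fintype.card (Fin (S.card + 1)) := by
        simp [hyS]
      obtain ⟨f₀⟩ := Fintype.card_eq.1 hcard
      have hy0 : y ∈ insert y S := by simp
      -- The numbering is arranged so that the root `y` receives the number `0`.
      set f := f₀.trans (Equiv.swap (f₀ ⟨y, hy0⟩) 0) with hfdef
      have hfy : f ⟨y, hy0⟩ = 0 := by simp [hfdef]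
      set emb : Fin (S.card + 1) ↪ V := f.symm.toEmbedding.trans (Function.Embedding.subtype _)
        with hemb
      have hemb_mem : ∀ i, emb i ∈ insert y S := fun i => (f.symm i).2
      have hembf : ∀ v (hv : v ∈ insert y S), emb (f ⟨v, hv⟩) = v := fun v hv => by
        simp [hemb]
      have hemb0 : emb 0 = y := by rw [← hfy]; exact hembf y hy0
      let e : G.comap emb ↪g G := ⟨emb, Iff.rfl⟩
      have himg : (Finset.univ.erase (0 : Fin (S.card + 1))).image emb = S := by
        ext v
        simp only [Finset.mem_image, Finset.mem_erase, Finset.mem_univ, and_true]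
        constructor
        · rintro ⟨i, hi, rfl⟩
          refine (Finset.mem_insert.1 (hemb_mem i)).resolve_left fun he => hi ?_
          exact emb.injective (he.trans hemb0.symm)
        · intro hv
          refine ⟨f ⟨v, by simp [hv]⟩, fun he => ?_, hembf v _⟩
          have := hembf v (by simp [hv])
          rw [he, hemb0] at this
          exact hyS (this ▸ hv)
      have hτ : Tight (G.comap emb) {0} (Finset.univ.erase 0) := by
        rw [← tight_image_iff (G' := G) (h := emb) emb.injective.injOn (fun _ _ _ _ => Iff.rfl),
          himg, Finset.image_singleton, hemb0]
        exact hS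
      have hnear : ∀ v ∈ insert y S, Near G s y v := by
        intro v hv
        rcases Finset.mem_insert.1 hv with rfl | hv
        · exact Near.refl _ _
        · exact hn v hv
      -- All of `y` and `S` is far from the closure, hence outside `D`, so its type is rich.
      have hR := hG.rich_of_embedding S.card (hs.trans hsK) (G.comap emb) e fun i hi =>
        hf.not_mem (hnear _ (hemb_mem i)) (Or.inl (hD hi))
      obtain ⟨e', hn', hf'⟩ := hG'.exists_embedding s hsK S.card hs _ hR
        (Finset.card_pos.2 hne) hτ X' hD' hk'
      set g : V → V' := fun v => if hv : v ∈ insert y S then e' (f ⟨v, hv⟩) else e' 0 with hg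
      have hgv : ∀ v (hv : v ∈ insert y S), g v = e' (f ⟨v, hv⟩) := fun v hv => by
        simp only [hg, hv, dif_pos]
      have hgy : g y = e' 0 := by rw [hgv y hy0, hfy]
      refine Hs.insert_far (S₀ := S) (g := g) hf hS hs hn (fun he => absurd he hne.ne_empty)
        (by rwa [hgy]) ?_ (fun he => absurd he hne.ne_empty) ?_ ?_
      · intro v hv
        rw [hgy, hgv v (by simp [hv])]
        exact hn' _
      · intro u hu v hv huv
        rw [hgv u hu, hgv v hv] at huv
        have := f.injective (e'.injective huv)
        exact congrArg Subtype.val this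
      · intro u hu v hv
        rw [hgv u hu, hgv v hv, e'.map_adj_iff, SimpleGraph.comap_adj, hembf, hembf]
  · unfold IsFar at hf
    push Not at hf
    obtain ⟨x, hx, p, hp⟩ := hf
    exact IsPosition.insert_walk hG' hD' hk' (d := s + 1) (s := s)
      ((Nat.le_add_right _ _).trans hK) p hp H.image_base (H.insert_closure hx)

/-- The level at which a formula is preserved by positions. -/
def GraphFormula.level : GraphFormula → ℕ
  | .eq _ _ => 0
  | .adj _ _ => 0
  | .neg φ => φ.level
  | .conj φ ψ => max φ.level ψ.level
  | .disj φ ψ => max φ.level ψ.level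
  | .imp φ ψ => max φ.level ψ.level
  | .bicond φ ψ => max φ.level ψ.level
  | .all _ φ => moveLevel φ.level
  | .ex _ φ => moveLevel φ.level

end Game

theorem union_image_update {W : Type*} [DecidableEq W] {Vars : Finset ℕ} {x : ℕ} (hx : x ∈ Vars)
    (E : Finset W) (w : ℕ → W) (b : W) :
    E ∪ Vars.image (Function.update w x b) = insert b (E ∪ (Vars.erase x).image w) := by
  ext u
  simp only [Finset.mem_insert, Finset.mem_union, Finset.mem_image, Finset.mem_erase]
  constructor
  · rintro (hu | ⟨z, hz, rfl⟩)
    · exact Or.inr (Or.inl hu)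
    · by_cases hzx : z = x
      · subst hzx; simp
      · exact Or.inr (Or.inr ⟨z, ⟨hzx, hz⟩, by simp [hzx]⟩)
  · rintro (rfl | hu | ⟨z, ⟨hzx, hz⟩, rfl⟩)
    · exact Or.inr ⟨x, hx, by simp⟩
    · exact Or.inl hu
    · exact Or.inr ⟨z, hz, by simp [hzx]⟩

/-- The pebble of the requantified variable is lifted before it is placed again. Hence at most
`|Vars| - 1` pebbles lie outside the distinguished set when the move is answered. -/
theorem IsPosition.update {V V' : Type*} [DecidableEq V] [DecidableEq V'] {G : SimpleGraph V}
    {G' : SimpleGraph V'} {D : Finset V} {D' : Finset V'} {K : ℕ}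
    {R : ∀ c : ℕ, SimpleGraph (Fin (c + 1)) → Prop} {Vars : Finset ℕ}
    (hG : IsHomogeneous G D Vars.card K R) (hG' : IsHomogeneous G' D' Vars.card K R)
    {s : ℕ} (hK : moveLevel s ≤ K) {x : ℕ} (hx : x ∈ Vars) {h : V → V'} {v : ℕ → V} {v' : ℕ → V'}
    (hD : D.image h = D') (hv : ∀ z ∈ Vars, v' z = h (v z))
    (H : IsPosition G G' (moveLevel s) (D ∪ Vars.image v) (D' ∪ Vars.image v') h) (a : V) :
    ∃ (a' : V') (h' : V → V'), D.image h' = D' ∧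
      (∀ z ∈ Vars, Function.update v' x a' z = h' (Function.update v x a z)) ∧
      IsPosition G G' s (D ∪ Vars.image (Function.update v x a))
        (D' ∪ Vars.image (Function.update v' x a')) h' := by
  have himg : (D ∪ (Vars.erase x).image v).image h = D' ∪ (Vars.erase x).image v' := by
    rw [Finset.image_union, hD, Finset.image_image]
    congr 1
    exact Finset.image_congr fun z hz => (hv z (Finset.mem_of_mem_erase hz)).symm
  have H₁ := H.restrict (s := moveLevel s) (Y := D ∪ (Vars.erase x).image v)
    (tightClosure_mono le_rfl (Finset.union_subset_union subset_rfl
      (Finset.image_subset_image (Finset.erase_subset _ _))))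
    (by rw [himg]
        exact tightClosure_mono le_rfl (Finset.union_subset_union subset_rfl
          (Finset.image_subset_image (Finset.erase_subset _ _))))
  rw [himg] at H₁
  obtain ⟨h', he, H₂⟩ := IsPosition.extend hG hG' Finset.subset_union_left Finset.subset_union_left
    (by
      have h1 : ((D' ∪ (Vars.erase x).image v') \ D').card ≤ ((Vars.erase x).image v').card :=
        Finset.card_le_card (by intro w; simp only [Finset.mem_sdiff, Finset.mem_union]; tauto)
      have h2 : ((Vars.erase x).image v').card ≤ (Vars.erase x).card := Finset.card_image_le
      rw [Finset.card_erase_of_mem hx] at h2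
      have := Finset.card_pos.2 ⟨x, hx⟩
      omega) hK H₁ a
  refine ⟨h' a, h', ?_, ?_, ?_⟩
  · rw [← hD]
    exact Finset.image_congr fun w hw => he w (Finset.mem_union_left _ hw)
  · intro z hz
    by_cases hzx : z = x
    · subst hzx; simp
    · rw [Function.update_of_ne hzx, Function.update_of_ne hzx, hv z hz]
      refine (he _ (Finset.mem_union_right _ (Finset.mem_image_of_mem v ?_))).symm
      simp [hz, hzx]
  · rw [union_image_update hx, union_image_update hx]
    exact H₂

theorem GraphFormula.sat_iff_of_isPosition {K : ℕ}
    {R : ∀ c : ℕ, SimpleGraph (Fin (c + 1)) → Prop} {Vars : Finset ℕ} (φ : GraphFormula)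
    (hvars : φ.vars ⊆ Vars) (hK : φ.level ≤ K) {V V' : Type} [DecidableEq V] [DecidableEq V']
    {G : SimpleGraph V} {G' : SimpleGraph V'} {D : Finset V} {D' : Finset V'}
    (hG : IsHomogeneous G D Vars.card K R) (hG' : IsHomogeneous G' D' Vars.card K R)
    {h : V → V'} {v : ℕ → V} {v' : ℕ → V'}
    (hD : D.image h = D') (hv : ∀ z ∈ Vars, v' z = h (v z))
    (H : IsPosition G G' φ.level (D ∪ Vars.image v) (D' ∪ Vars.image v') h) :
    φ.Sat G v ↔ φ.Sat G' v' := by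
  -- The inverse of a position is a position; it answers the moves that are made in `G'`.
  have hback : ∀ {V V' : Type} [DecidableEq V] [DecidableEq V'] {G : SimpleGraph V}
      {G' : SimpleGraph V'} {D : Finset V} {D' : Finset V'} {h : V → V'} {v : ℕ → V} {v' : ℕ → V'}
      {s : ℕ}, D.image h = D' → (∀ z ∈ Vars, v' z = h (v z)) →
      IsPosition G G' s (D ∪ Vars.image v) (D' ∪ Vars.image v') h →
      ∃ g : V' → V, D'.image g = D ∧ (∀ z ∈ Vars, v z = g (v' z)) ∧
        IsPosition G' G s (D' ∪ Vars.image v') (D ∪ Vars.image v) g := by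
    intro V V' _ _ G G' D D' h v v' s hD hv H
    have : Nonempty V := ⟨v 0⟩
    obtain ⟨g, Hg, hg⟩ := H.symm
    refine ⟨g, ?_, ?_, Hg⟩
    · rw [← hD, Finset.image_image]
      conv_rhs => rw [← Finset.image_id (s := D)]
      exact Finset.image_congr fun w hw => hg w (Or.inl (Finset.mem_union_left _ hw))
    · intro z hz
      rw [hv z hz, hg _ (Or.inl (Finset.mem_union_right _ (Finset.mem_image_of_mem v hz)))]
  have hmem : ∀ z ∈ Vars, ∀ s, v z ∈ tightClosure G s (D ∪ Vars.image v) := fun z hz s =>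
    Or.inl (Finset.mem_union_right _ (Finset.mem_image_of_mem v hz))
  induction φ generalizing V V' with
  | eq x y =>
    have hx : x ∈ Vars := hvars (by simp [vars])
    have hy : y ∈ Vars := hvars (by simp [vars])
    simp only [Sat]
    rw [hv x hx, hv y hy]
    exact (H.injOn.eq_iff (hmem x hx _) (hmem y hy _)).symm
  | adj x y =>
    have hx : x ∈ Vars := hvars (by simp [vars])
    have hy : y ∈ Vars := hvars (by simp [vars])
    simp only [Sat]
    rw [hv x hx, hv y hy]
    exact (H.adj_iff _ (hmem x hx _) _ (hmem y hy _)).symm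
  | neg φ ih =>
    have h₁ := ih hvars hK hG hG' hD hv H hmem
    simp only [Sat, h₁]
  | conj φ ψ ih₁ ih₂ | disj φ ψ ih₁ ih₂ | imp φ ψ ih₁ ih₂ | bicond φ ψ ih₁ ih₂ =>
    simp only [vars, level] at hvars hK H
    have h₁ := ih₁ (Finset.union_subset_left hvars) (le_of_max_le_left hK) hG hG' hD hv
      (H.mono (le_max_left _ _)) hmem
    have h₂ := ih₂ (Finset.union_subset_right hvars) (le_of_max_le_right hK) hG hG' hD hv
      (H.mono (le_max_right _ _)) hmem
    simp only [Sat, h₁, h₂]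
  | all x φ ih =>
    simp only [vars, level] at hvars hK H
    have hx : x ∈ Vars := hvars (by simp)
    have hφ : φ.vars ⊆ Vars := (Finset.subset_insert _ _).trans hvars
    have hφK := (le_moveLevel φ.level).trans hK
    simp only [Sat]
    constructor
    · intro hs a'
      obtain ⟨g, hD', hv', Hg⟩ := hback hD hv H
      obtain ⟨a, g', hD₁, hv₁, H₁⟩ := IsPosition.update hG' hG hK hx hD' hv' Hg a'
      refine (ih hφ hφK hG' hG hD₁ hv₁ H₁ ?_).2 (hs a)
      exact fun z hz s => Or.inl (Finset.mem_union_right _ (Finset.mem_image_of_mem _ hz))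
    · intro hs a
      obtain ⟨a', h', hD₁, hv₁, H₁⟩ := IsPosition.update hG hG' hK hx hD hv H a
      refine (ih hφ hφK hG hG' hD₁ hv₁ H₁ ?_).2 (hs a')
      exact fun z hz s => Or.inl (Finset.mem_union_right _ (Finset.mem_image_of_mem _ hz))
  | ex x φ ih =>
    simp only [vars, level] at hvars hK H
    have hx : x ∈ Vars := hvars (by simp)
    have hφ : φ.vars ⊆ Vars := (Finset.subset_insert _ _).trans hvars
    have hφK := (le_moveLevel φ.level).trans hK
    simp only [Sat]
    constructor
    · rintro ⟨a, hs⟩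
      obtain ⟨a', h', hD₁, hv₁, H₁⟩ := IsPosition.update hG hG' hK hx hD hv H a
      refine ⟨a', (ih hφ hφK hG hG' hD₁ hv₁ H₁ ?_).1 hs⟩
      exact fun z hz s => Or.inl (Finset.mem_union_right _ (Finset.mem_image_of_mem _ hz))
    · rintro ⟨a', hs⟩
      obtain ⟨g, hD', hv', Hg⟩ := hback hD hv H
      obtain ⟨a, g', hD₁, hv₁, H₁⟩ := IsPosition.update hG' hG hK hx hD' hv' Hg a'
      refine ⟨a, (ih hφ hφK hG' hG hD₁ hv₁ H₁ ?_).1 hs⟩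
      exact fun z hz s => Or.inl (Finset.mem_union_right _ (Finset.mem_image_of_mem _ hz))

/-! ### Fresh neighbours outside the closure -/

section Fresh

variable {V : Type*} [DecidableEq V] {G : SimpleGraph V} {D E X : Finset V} {k u : ℕ}

theorem union_sdiff_eq (W T Y : Finset V) :
    (W ∪ T) \ Y = W \ Y ∪ T \ (W ∪ Y) := by
  ext a
  simp only [Finset.mem_sdiff, Finset.mem_union]
  tauto

theorem union_union_eq (W T Y : Finset V) : (W ∪ T) ∪ Y = T \ (W ∪ Y) ∪ (W ∪ Y) := by
  ext a
  simp only [Finset.mem_sdiff, Finset.mem_union]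
  tauto

/-- If the sets that are tight over `D` lie in `E`, closures of sets with `k` vertices outside of `D`
have bounded size. -/
theorem card_le_of_subset_tightClosure (hDX : D ⊆ X) (hk : (X \ D).card ≤ k) (hDE : D ⊆ E)
    (hE : ∀ S, Tight G D S → S.card ≤ (k + 2) * u + k → S ⊆ E) {Y : Finset V}
    (hY : (Y : Set V) ⊆ tightClosure G u X) : Y.card ≤ E.card + k + k * u := by
  by_contra hlt
  -- Each vertex of `Y` that is not yet covered brings a further tight set, raising the excess of
  -- edges by one. All `Z ⊆ E` are treated at once because the kernel to which this is applied
  -- depends on the final `W`.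
  have hgrow : ∀ j ≤ k + 1, ∃ W : Finset V, W.card ≤ j * u ∧ ∀ Z ⊆ E,
      2 * (W \ (X ∪ Z)).card + 2 * j ≤ dartCount G (W ∪ (X ∪ Z)) (W \ (X ∪ Z)) := by
    intro j
    induction j with
    | zero => exact fun _ => ⟨∅, by simp, by simp⟩
    | succ j ih =>
      intro hj
      obtain ⟨W, hW, hWd⟩ := ih (by omega)
      obtain ⟨y, hyY, hyn⟩ : ∃ y ∈ Y, y ∉ W ∪ (E ∪ (X \ D)) := by
        by_contra hcon
        push Not at hcon
        have h1 := Finset.card_le_card hcon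
        have h2 := Finset.card_union_le W (E ∪ (X \ D))
        have h3 := Finset.card_union_le E (X \ D)
        have h4 : j * u ≤ k * u := Nat.mul_le_mul_right _ (by omega)
        omega
      simp only [Finset.mem_union, Finset.mem_sdiff, not_or, not_and, not_not] at hyn
      obtain ⟨hyW, hyE, hyX⟩ := hyn
      have hyX : y ∉ X := fun h => hyE (hDE (hyX h))
      rcases hY hyY with h | ⟨T, hT, hTu, hyT⟩
      · exact absurd h hyX
      refine ⟨W ∪ T, ?_, fun Z hZ => ?_⟩
      · refine (Finset.card_union_le _ _).trans ?_
        rw [Nat.add_mul, one_mul]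
        omega
      · have k1 := hWd Z hZ
        set P := T \ (W ∪ (X ∪ Z)) with hP
        have hPt : Tight G (W ∪ (X ∪ Z)) P := hT.mono (by intro a; simp; tauto)
        have k2 := hPt.2 P subset_rfl ⟨y, by
          simp only [hP, Finset.mem_sdiff, Finset.mem_union, not_or]
          exact ⟨hyT, hyW, hyX, fun h => hyE (hZ h)⟩⟩
        have k3 := dartCount_add_le G (Z₁ := W ∪ (X ∪ Z)) (Z := P ∪ (W ∪ (X ∪ Z)))
          (U₁ := W \ (X ∪ Z)) (U₂ := P) Finset.subset_union_right Finset.sdiff_disjoint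
        have e1 : (W ∪ T) \ (X ∪ Z) = W \ (X ∪ Z) ∪ P :=
          union_sdiff_eq W T _
        have e2 : (W ∪ T) ∪ (X ∪ Z) = P ∪ (W ∪ (X ∪ Z)) :=
          union_union_eq W T _
        have e3 : (W \ (X ∪ Z) ∪ P).card = (W \ (X ∪ Z)).card + P.card := by
          refine Finset.card_union_of_disjoint ?_
          exact (Finset.sdiff_disjoint.mono_right
            (Finset.sdiff_subset.trans Finset.subset_union_left)).symm
        rw [e1, e2, e3]
        omega
  obtain ⟨W, hW, hWd⟩ := hgrow (k + 1) le_rfl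
  obtain ⟨Z, hZ, hZt, hZk⟩ := exists_tight_kernel (G := G) (W := (W ∪ (X \ D)) \ D) (X := D)
    Finset.sdiff_disjoint
  have c1 : ((W ∪ (X \ D)) \ D).card ≤ (k + 1) * u + k :=
    (Finset.card_le_card Finset.sdiff_subset).trans
      ((Finset.card_union_le _ _).trans (by omega))
  have hZE : Z ⊆ E := hE Z hZt ((Finset.card_le_card hZ).trans (c1.trans (by
    have : (k + 1) * u ≤ (k + 2) * u := Nat.mul_le_mul_right _ (by omega)
    omega)))
  have k1 := hWd Z hZE
  set U := ((W ∪ (X \ D)) \ D) \ Z with hU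
  have k2 := hZk U subset_rfl
  have hsub : W \ (X ∪ Z) ⊆ U := by
    intro a
    simp only [hU, Finset.mem_sdiff, Finset.mem_union, not_or]
    rintro ⟨h1, h2, h3⟩
    exact ⟨⟨Or.inl h1, fun h => h2 (hDX h)⟩, h3⟩
  have k3 : dartCount G (W ∪ (X ∪ Z)) (W \ (X ∪ Z)) ≤ dartCount G (U ∪ (Z ∪ D)) U := by
    refine dartCount_mono G ?_ hsub
    intro a
    simp only [hU, Finset.mem_sdiff, Finset.mem_union]
    tauto
  -- Passing from base `X ∪ Z` to base `D ∪ Z` adds at most `k` vertices, which cannot absorb an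
  -- excess of `k + 1`.
  have k4 : U.card ≤ (W \ (X ∪ Z)).card + k := by
    have : U ⊆ (W \ (X ∪ Z)) ∪ (X \ D) := by
      intro a
      simp only [hU, Finset.mem_sdiff, Finset.mem_union]
      tauto
    exact (Finset.card_le_card this).trans ((Finset.card_union_le _ _).trans (by omega))
  omega

/-- For `x ∈ E` the neighbours are too many for the closure. For `x ∉ E`, suppose that `k + 2`
neighbours lie in the closure, and consider the component of `x` in the union of the pebbles and the
witnessing tight sets, outside the kernel over `D`. A vertex of a tight set has degree at least 2,
another pebble at least 1, and `x` at least `k + 2`; with at most `k - 1` other pebbles, the degree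
sum exceeds twice the number of vertices, against the kernel. -/
theorem exists_adj_notMem_tightClosure (hDX : D ⊆ X) (hk : (X \ D).card ≤ k) (hDE : D ⊆ E)
    (hE : ∀ S, Tight G D S → S.card ≤ (k + 2) * u + k → S ⊆ E)
    (hin : ∀ x ∈ E, ∃ Y : Finset V, E.card + k + k * u < Y.card ∧ ∀ y ∈ Y, G.Adj x y)
    (hout : ∀ x ∉ E, ∃ Y : Finset V, Y.card = k + 2 ∧ ∀ y ∈ Y, G.Adj x y) {x : V} (hx : x ∈ X) :
    ∃ y, G.Adj x y ∧ y ∉ tightClosure G u X := by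
  classical
  by_contra hcon
  push Not at hcon
  by_cases hxE : x ∈ E
  · obtain ⟨Y, hYc, hY⟩ := hin x hxE
    have := card_le_of_subset_tightClosure hDX hk hDE hE (Y := Y) fun y hy => hcon y (hY y hy)
    omega
  · obtain ⟨Y, hYc, hY⟩ := hout x hxE
    have hS : ∀ y : V, ∃ S : Finset V, Tight G X S ∧ S.card ≤ u ∧ (y ∈ Y → y ∈ S ∪ X) := by
      intro y
      by_cases hy : y ∈ Y
      · rcases hcon y (hY y hy) with h | ⟨S, hS, hu, hyS⟩
        · exact ⟨∅, tight_empty, by simp, by simp [h]⟩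
        · exact ⟨S, hS, hu, by simp [hyS]⟩
      · exact ⟨∅, tight_empty, by simp, by simp [hy]⟩
    choose S hSt hSc hSy using hS
    have hxD : x ∉ D := fun h => hxE (hDE h)
    set A := X \ D with hA
    set W := (A ∪ Y.biUnion S) \ D with hW
    have hYW : Y ⊆ W ∪ D := by
      intro y hy
      have := hSy y hy
      simp only [hW, hA, Finset.mem_union, Finset.mem_sdiff, Finset.mem_biUnion] at this ⊢
      rcases this with h | h
      · by_cases hyD : y ∈ D
        · exact Or.inr hyD
        · exact Or.inl ⟨Or.inr ⟨y, hy, h⟩, hyD⟩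
      · tauto
    have hWc : W.card ≤ (k + 2) * u + k := by
      refine (Finset.card_le_card Finset.sdiff_subset).trans ((Finset.card_union_le _ _).trans ?_)
      have := Finset.card_biUnion_le_card_mul Y S u fun y _ => hSc y
      rw [hYc] at this
      omega
    obtain ⟨Z, hZ, hZt, hZk⟩ := exists_tight_kernel (G := G) (W := W) (X := D)
      Finset.sdiff_disjoint
    have hZE : Z ⊆ E := hE Z hZt ((Finset.card_le_card hZ).trans hWc)
    have hxW : x ∈ W \ Z := by
      simp only [hW, hA, Finset.mem_sdiff, Finset.mem_union]
      exact ⟨⟨Or.inl ⟨hx, hxD⟩, hxD⟩, fun h => hxE (hZE h)⟩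
    obtain ⟨Q, hQ, -, hQ2, hQ3⟩ := exists_component G ((W \ Z).erase x) {x}
    have hxQ : x ∉ Q := fun h => by simpa using hQ h
    have hUsub : {x} ∪ Q ⊆ W \ Z := by
      intro a ha
      rcases Finset.mem_union.1 ha with h | h
      · rw [Finset.mem_singleton.1 h]; exact hxW
      · exact Finset.mem_of_mem_erase (hQ h)
    have k1 := hZk ({x} ∪ Q) hUsub
    set T := ({x} ∪ Q) ∪ (Z ∪ D) with hT
    have hmemT : ∀ a ∈ {x} ∪ Q, ∀ b ∈ W ∪ D, G.Adj a b → b ∈ T := by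
      intro a ha b hb hab
      by_contra hbT
      simp only [hT, Finset.mem_union, Finset.mem_singleton, not_or] at hbT
      refine hQ3 a ha b ?_ hab
      simp only [Finset.mem_sdiff, Finset.mem_erase]
      rcases Finset.mem_union.1 hb with hb | hb
      · exact ⟨⟨hbT.1.1, hb, hbT.2.1⟩, hbT.1.2⟩
      · exact absurd hb hbT.2.2
    have hdx : k + 2 ≤ (T.filter (G.Adj x)).card := by
      rw [← hYc]
      refine Finset.card_le_card fun y hy => ?_
      rw [Finset.mem_filter]
      exact ⟨hmemT x (by simp) y (hYW hy) (hY y hy), hY y hy⟩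
    have hdQ : ∀ v ∈ Q, 2 ≤ (T.filter (G.Adj v)).card + if v ∈ A then 1 else 0 := by
      intro v hv
      have hvU : v ∈ {x} ∪ Q := by simp [hv]
      split_ifs with hvA
      · obtain ⟨w, hw, hvw⟩ := hQ2 v hv
        have : 0 < (T.filter (G.Adj v)).card :=
          Finset.card_pos.2 ⟨w, Finset.mem_filter.2 ⟨Finset.mem_union_left _ hw, hvw⟩⟩
        omega
      · have hvW := hUsub hvU
        simp only [hW, Finset.mem_sdiff, Finset.mem_union, Finset.mem_biUnion] at hvW
        obtain ⟨⟨h | ⟨y, hy, hvS⟩, hvD⟩, -⟩ := hvW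
        · exact absurd h hvA
        -- Tightness applied to the singleton `{v}` gives degree at least 2.
        have h4 := (hSt y).2 {v} (by simpa using hvS) (by simp)
        have h5 := dartCount_singleton_le G (S y ∪ X) v
        have h6 : ((S y ∪ X).filter (G.Adj v)).card ≤ (T.filter (G.Adj v)).card := by
          refine Finset.card_le_card fun b hb => ?_
          rw [Finset.mem_filter] at hb ⊢
          refine ⟨hmemT v hvU b ?_ hb.2, hb.2⟩
          simp only [hW, hA, Finset.mem_union, Finset.mem_sdiff, Finset.mem_biUnion]
          by_cases hbD : b ∈ D
          · exact Or.inr hbD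
          · rcases Finset.mem_union.1 hb.1 with h | h
            · exact Or.inl ⟨Or.inr ⟨y, hy, h⟩, hbD⟩
            · exact Or.inl ⟨Or.inl ⟨h, hbD⟩, hbD⟩
        rw [Finset.card_singleton] at h4
        omega
    have k2 := sum_degree_le_dartCount G (Z := T) (U := {x} ∪ Q) Finset.subset_union_left
    rw [Finset.sum_union (by simpa using hxQ), Finset.sum_singleton] at k2
    have k3 := Finset.sum_le_sum hdQ
    rw [Finset.sum_add_distrib, Finset.sum_const, smul_eq_mul, ← Finset.card_filter] at k3
    -- The vertex `x` is itself one of the `k` pebbles. This saving of one is needed: the degree sum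
    -- is at least `2 * |Q| + 3`, against the bound `2 * |Q| + 2`.
    have k4 : (Q.filter (· ∈ A)).card + 1 ≤ k := by
      have : insert x (Q.filter (· ∈ A)) ⊆ A := by
        intro a ha
        rcases Finset.mem_insert.1 ha with rfl | ha
        · simp [hA, hx, hxD]
        · exact (Finset.mem_filter.1 ha).2
      have := Finset.card_le_card this
      rw [Finset.card_insert_of_notMem (by simp [hxQ])] at this
      omega
    have k5 : ({x} ∪ Q).card = 1 + Q.card := by
      rw [Finset.card_union_of_disjoint (by simpa using hxQ), Finset.card_singleton]
    omega

end Fresh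

/-! ### The infinite graph: isolated vertices and recurring configurations -/

/-- Over every initial segment, the tight sets of bounded size are bounded. -/
def TightBounded (G : SimpleGraph ℕ) : Prop :=
  ∀ N b : ℕ, ∃ B, ∀ S, Tight G (Finset.range N) S → S.card ≤ b → S ⊆ Finset.range B

/-- There is no short walk from the first `N` vertices to `z`. -/
def IsIsolated (G : SimpleGraph ℕ) (j N z : ℕ) : Prop := ∀ w < N, ¬ Near G j w z

/-- There are copies of `τ` outside of every initial segment. -/
def IsRich (G : SimpleGraph ℕ) (c : ℕ) (τ : SimpleGraph (Fin (c + 1))) : Prop :=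
  ∀ N, ∃ e : τ ↪g G, ∀ i, N ≤ e i

section Infinite

variable {G : SimpleGraph ℕ}

theorem TightBounded.exists_bound (hG : TightBounded G) : ∃ bd : ℕ → ℕ → ℕ, (∀ N b, N ≤ bd N b) ∧
    ∀ N b S, Tight G (Finset.range N) S → S.card ≤ b → S ⊆ Finset.range (bd N b) := by
  choose B hB using hG
  refine ⟨fun N b => max N (B N b), fun N b => le_max_left _ _, fun N b S hS hb => ?_⟩
  exact (hB N b S hS hb).trans (Finset.range_subset_range.2 (le_max_right _ _))

theorem dartCount_le_erase {V : Type*} [DecidableEq V] (G : SimpleGraph V) (T U : Finset V)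
    (w : V) : dartCount G T U ≤ dartCount G T (T.erase w) := by
  classical
  refine Finset.card_le_card fun p hp => ?_
  simp only [Finset.mem_filter, Finset.mem_product, Finset.mem_erase] at hp ⊢
  refine ⟨hp.1, hp.2.1, ?_⟩
  by_cases h : p.1 = w
  · exact Or.inr ⟨fun h' => hp.2.1.ne (h.trans h'.symm), hp.1.2⟩
  · exact Or.inl ⟨h, hp.1.1⟩

/-- A set beyond the bound contains no nonempty tight subset, so it has no excess of edges. -/
theorem dartCount_lt_of_le {M b B : ℕ} (hMB : M ≤ B)
    (hB : ∀ S, Tight G (Finset.range M) S → S.card ≤ b → S ⊆ Finset.range B) {W : Finset ℕ}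
    (hW : ∀ v ∈ W, B ≤ v) (hb : W.card ≤ b) :
    dartCount G (W ∪ Finset.range M) W < 2 * W.card + 2 := by
  by_contra hlt
  obtain ⟨Z, hZ, ⟨z, hz⟩, hZt⟩ := exists_tight_of_le_dartCount (G := G) (W := W)
    (X := Finset.range M) (by
      rw [Finset.disjoint_left]
      intro a ha hr
      have := hW a ha
      rw [Finset.mem_range] at hr
      omega) (by omega)
  have h1 := hB Z hZt ((Finset.card_le_card hZ).trans hb) hz
  have h2 := hW z (hZ hz)
  rw [Finset.mem_range] at h1
  omega

/-- A bounded walk from an initial segment has a gap between the scales that it visits. -/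
theorem exists_walk_gap (G : SimpleGraph ℕ) {f : ℕ → ℕ} (hf : ∀ N, N ≤ f N) (N j : ℕ) :
    ∃ N', N ≤ N' ∧ ∀ (w u : ℕ) (q : G.Walk w u), w < N → q.length ≤ j →
      ∃ M, N ≤ M ∧ f M ≤ N' ∧ ∃ w' < M, ∃ q' : G.Walk w' u, q'.length ≤ j ∧
        q'.support ⊆ q.support ∧ ∀ v ∈ q'.support, v ≠ w' → f M ≤ v := by
  induction j generalizing N with
  | zero =>
    refine ⟨f N, hf N, fun w u q hw hq => ⟨N, le_rfl, le_rfl, w, hw, q, hq, by simp, ?_⟩⟩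
    cases q with
    | nil => simp
    | cons h p => simp at hq
  | succ j ih =>
    obtain ⟨N', hN', h⟩ := ih (f N)
    refine ⟨N', (hf N).trans hN', fun w u q hw hq => ?_⟩
    cases q with
    | nil => exact ⟨N, le_rfl, hN', w, hw, .nil, by simp, by simp, by simp⟩
    | @cons _ x _ hwx p =>
      simp only [SimpleGraph.Walk.length_cons, add_le_add_iff_right] at hq
      -- If the walk returns below `f N`, it is cut there and the next scale is used; otherwise
      -- there is a gap at scale `N`. The length drops each time, so `j + 1` scales suffice.
      by_cases hp : ∃ v ∈ p.support, v < f N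
      · obtain ⟨v, hv, hvN⟩ := hp
        obtain ⟨M, hM, hMN, w', hw', q', hq', hs, hg⟩ := h v u (p.dropUntil v hv) hvN
          ((p.length_dropUntil_le_length hv).trans hq)
        refine ⟨M, (hf N).trans hM, hMN, w', hw', q', by omega, ?_, hg⟩
        intro a ha
        simp [p.support_dropUntil_subset_support hv (hs ha)]
      · push Not at hp
        refine ⟨N, le_rfl, hN', w, hw, .cons hwx p, by simpa using hq, by simp, ?_⟩
        intro v hv hne
        simp only [SimpleGraph.Walk.support_cons, List.mem_cons] at hv
        exact hp v (hv.resolve_left hne)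

/-- A short walk from the first `N` vertices to `y`, together with `S`, would have an excess of
edges. The gap puts all of its vertices except the start of the walk beyond the bound for tight sets
over `range M`. -/
theorem TightBounded.exists_not_near (hG : TightBounded G) (N j s : ℕ) :
    ∃ N', N ≤ N' ∧ ∀ (y : ℕ) (S : Finset ℕ), Tight G {y} S → S.Nonempty → S.card ≤ s →
      (∀ v ∈ insert y S, N' ≤ v) → IsIsolated G j N y := by
  obtain ⟨bd, hbd, hbt⟩ := hG.exists_bound
  obtain ⟨N', hN', hgap⟩ := exists_walk_gap G (f := fun M => bd M (j + 1 + (s + 1)))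
    (fun M => hbd M _) N j
  refine ⟨N', hN', fun y S hS hne hs hN w hw ⟨q, hq⟩ => ?_⟩
  obtain ⟨M, hNM, hMN, w', hw', q', hq', -, hg⟩ := hgap w y q hw hq
  have hyS : y ∉ S := Finset.disjoint_singleton_right.1 hS.1
  set Z := S ∪ {y} with hZ
  set T := q'.reverse.support.toFinset ∪ Z with hT
  have k1 := hS.2 S subset_rfl hne
  have k2 := two_mul_card_support_le_dartCount q'.reverse Z (by simp [hZ])
  have k3 := dartCount_add_le G (Z₁ := Z) (Z := T) (U₁ := S)
    (U₂ := q'.reverse.support.toFinset \ Z) Finset.subset_union_right Finset.sdiff_disjoint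
  have k4 := dartCount_le_erase G T (S ∪ (q'.reverse.support.toFinset \ Z)) w'
  have hZc : Z.card = S.card + 1 := by
    rw [hZ, Finset.card_union_of_disjoint (by simpa using hyS), Finset.card_singleton]
  have hTc : T.card = (q'.reverse.support.toFinset \ Z).card + Z.card := by
    rw [hT, ← Finset.sdiff_union_self_eq_union, Finset.card_union_of_disjoint
      Finset.sdiff_disjoint]
  have hw'T : w' ∈ T := by simp [hT]
  have hTb : T.card ≤ j + 1 + (s + 1) := by
    have h1 : q'.reverse.support.toFinset.card ≤ j + 1 := by
      refine (List.toFinset_card_le _).trans ?_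
      simpa using hq'
    have h2 := Finset.card_union_le q'.reverse.support.toFinset Z
    rw [← hT] at h2
    omega
  have hmem : ∀ v ∈ T.erase w', bd M (j + 1 + (s + 1)) ≤ v := by
    intro v hv
    rw [Finset.mem_erase] at hv
    obtain ⟨hne', hv⟩ := hv
    rw [hT, Finset.mem_union] at hv
    rcases hv with hv | hv
    · refine hg v ?_ hne'
      simpa using hv
    · refine hMN.trans (hN v ?_)
      rw [hZ, Finset.mem_union, Finset.mem_singleton] at hv
      exact Finset.mem_insert.2 hv.symm
  have k5 := dartCount_lt_of_le (hbd M _) (hbt M (j + 1 + (s + 1))) hmem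
    ((Finset.card_le_card (Finset.erase_subset _ _)).trans hTb)
  have k6 : dartCount G T (T.erase w') ≤
      dartCount G (T.erase w' ∪ Finset.range M) (T.erase w') := by
    refine dartCount_mono G ?_ subset_rfl
    intro v hv
    by_cases h : v = w'
    · exact Finset.mem_union_right _ (Finset.mem_range.2 (h ▸ hw'))
    · exact Finset.mem_union_left _ (Finset.mem_erase.2 ⟨h, hv⟩)
  rw [Finset.card_erase_of_mem hw'T] at k5
  rw [← hZ] at k1
  rw [← hT] at k2
  have := Finset.card_pos.2 ⟨w', hw'T⟩
  omega

/-- If a short walk from below reached the late vertex `z₁` through another neighbour than `z`, then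
`z₁` would bring two edges to the walk and the initial segment, an excess beyond the bound. -/
theorem TightBounded.exists_unique_approach (hG : TightBounded G) (N j : ℕ) :
    ∃ N', N ≤ N' ∧ ∀ z₁ z w u : ℕ, N' ≤ z₁ → z < N → w < N → G.Adj z z₁ → G.Adj u z₁ →
      ∀ q : G.Walk w u, q.length ≤ j → z₁ ∉ q.support → u = z := by
  obtain ⟨bd, hbd, hbt⟩ := hG.exists_bound
  obtain ⟨N', hN', hgap⟩ := exists_walk_gap G (f := fun M => bd M (j + 2)) (fun M => hbd M _) N j
  refine ⟨N', hN', fun z₁ z w u hz₁ hz hw hzz huz q hq hqz => ?_⟩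
  by_contra huz'
  obtain ⟨M, hNM, hMN, w', hw', q', hq', hqs, hg⟩ := hgap w u q hw hq
  set P := q'.support.toFinset \ Finset.range M with hP
  have hz₁M : z₁ ∉ Finset.range M := by
    have := hbd M (j + 2)
    rw [Finset.mem_range]; omega
  have hz₁q : z₁ ∉ q'.support.toFinset := fun h => hqz (hqs (List.mem_toFinset.1 h))
  have k1 := two_mul_card_support_le_dartCount q' (Finset.range M) (Finset.mem_range.2 hw')
  rw [← hP] at k1
  have e : q'.support.toFinset ∪ Finset.range M = P ∪ Finset.range M :=
    (Finset.sdiff_union_self_eq_union ..).symm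
  rw [e] at k1
  have k2 := dartCount_add_le G (Z₁ := P ∪ Finset.range M) (Z := (P ∪ {z₁}) ∪ Finset.range M)
    (U₁ := P) (U₂ := {z₁}) (by intro a; simp only [Finset.mem_union]; tauto) (by
      rw [Finset.disjoint_singleton_left, ← e, Finset.mem_union]
      tauto)
  have k3 := two_mul_card_le_dartCount_singleton G (Z := (P ∪ {z₁}) ∪ Finset.range M)
    (Y := {u, z}) (v := z₁) (by simp) (by
      intro a ha
      rw [Finset.mem_insert, Finset.mem_singleton] at ha
      rcases ha with rfl | rfl
      · have : a ∈ P ∪ Finset.range M := by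
          rw [← e, Finset.mem_union]; exact Or.inl (by simp)
        simp only [Finset.mem_union] at this ⊢
        tauto
      · exact Finset.mem_union_right _ (Finset.mem_range.2 (by omega)))
    (by simp [huz.symm, hzz.symm])
  rw [Finset.card_pair huz'] at k3
  have hz₁P : z₁ ∉ P := fun h => hz₁q (Finset.mem_sdiff.1 h).1
  have hc : (P ∪ {z₁}).card = P.card + 1 := by
    rw [Finset.card_union_of_disjoint (by simpa using hz₁P), Finset.card_singleton]
  have hPc : P.card ≤ j + 1 := by
    refine (Finset.card_le_card Finset.sdiff_subset).trans ((List.toFinset_card_le _).trans ?_)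
    simpa using hq'
  have k4 := dartCount_lt_of_le (hbd M _) (hbt M (j + 2)) (W := P ∪ {z₁}) (by
    intro v hv
    rw [Finset.mem_union, Finset.mem_singleton] at hv
    rcases hv with hv | rfl
    · rw [hP, Finset.mem_sdiff, List.mem_toFinset, Finset.mem_range] at hv
      exact hg v hv.1 (by rintro rfl; exact hv.2 hw')
    · omega) (by omega)
  omega

theorem IsIsolated.mono {j j' N N' z : ℕ} (h : IsIsolated G j N z) (hj : j' ≤ j) (hN : N' ≤ N) :
    IsIsolated G j' N' z := fun w hw hn => h w (hw.trans_le hN) (hn.mono hj)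

theorem IsIsolated.le {j N z : ℕ} (h : IsIsolated G j N z) : N ≤ z := by
  by_contra hlt
  exact h z (by omega) (Near.refl _ _)

/-- A very late neighbour of `z` can be reached by a short path from the initial segment only
through `z`, so it is one step further away. -/
theorem IsIsolated.exists_adj (hG : TightBounded G) (hinf : ∀ v N : ℕ, ∃ w, N ≤ w ∧ G.Adj v w)
    {j N z : ℕ} (h : IsIsolated G j N z) : ∃ z₁, G.Adj z z₁ ∧ IsIsolated G (j + 1) N z₁ := by
  obtain ⟨N', hN', hu⟩ := hG.exists_unique_approach (max N (z + 1)) j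
  obtain ⟨z₁, hz₁, hadj⟩ := hinf z N'
  refine ⟨z₁, hadj, fun w hw ⟨q, hq⟩ => ?_⟩
  -- Passing to a path ensures that `z₁` is not revisited, as the unique approach requires.
  have hp := q.reverse.bypass_isPath
  have hl : q.reverse.bypass.length ≤ j + 1 := by
    refine q.reverse.length_bypass_le_length.trans ?_
    simpa using hq
  generalize q.reverse.bypass = p at hp hl
  cases p with
  | nil => omega
  | @cons _ u _ hzu p =>
    rw [SimpleGraph.Walk.cons_isPath_iff] at hp
    simp only [SimpleGraph.Walk.length_cons, add_le_add_iff_right] at hl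
    have := hu z₁ z w u hz₁ (by omega) (by omega) hadj hzu.symm p.reverse (by simpa using hl)
      (by simpa using hp.2)
    subst this
    exact h w hw ⟨p.reverse, by simpa using hl⟩

/-- Repeated late neighbours lead from the vertex `0` to a vertex that is isolated from a long
segment and still at bounded distance from `0`. That distance excludes a late tight set over it, by
`exists_not_near`. -/
theorem TightBounded.exists_isolated_treelike (hG : TightBounded G)
    (hinf : ∀ v N : ℕ, ∃ w, N ≤ w ∧ G.Adj v w) (s N j : ℕ) :
    ∃ z, (∀ S, Tight G {z} S → S.card ≤ s → (∀ v ∈ S, Near G s z v) → S = ∅) ∧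
      IsIsolated G j N z := by
  obtain ⟨N', hN', hiso⟩ := hG.exists_not_near (N + 1) (max j s + 1) s
  have hchain : ∀ i : ℕ, ∃ x, Near G (i + 1) 0 x ∧ IsIsolated G i N' x := by
    intro i
    induction i with
    | zero =>
      obtain ⟨x, hx, hadj⟩ := hinf 0 N'
      refine ⟨x, Near.of_adj hadj, fun w hw ⟨q, hq⟩ => ?_⟩
      have := SimpleGraph.Walk.eq_of_length_eq_zero (p := q) (by omega)
      omega
    | succ i ih =>
      obtain ⟨x, hx, hxi⟩ := ih
      obtain ⟨x', hadj, hx'⟩ := hxi.exists_adj hG hinf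
      exact ⟨x', hx.trans (Near.of_adj hadj), hx'⟩
  obtain ⟨z, hz, hzi⟩ := hchain (max j s)
  refine ⟨z, fun S hS hs hn => ?_, hzi.mono (le_max_left _ _) (by omega)⟩
  by_contra hne
  refine hiso z S hS (Finset.nonempty_iff_ne_empty.2 hne) hs ?_ 0 (by omega) hz
  intro v hv
  rcases Finset.mem_insert.1 hv with rfl | hv
  · exact hzi.le
  · by_contra hlt
    exact hzi v (by omega) ((hn v hv).symm.mono (le_max_right _ _))

theorem IsRich.exists_isolated (hG : TightBounded G) {c : ℕ} {τ : SimpleGraph (Fin (c + 1))}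
    (hτ : IsRich G c τ) (ht : Tight τ {0} (Finset.univ.erase 0)) (hc : 1 ≤ c) (L N j : ℕ) :
    ∃ z, (∃ e : τ ↪g G, e 0 = z ∧ ∀ i, L ≤ e i) ∧ IsIsolated G j N z := by
  obtain ⟨N', hN', hiso⟩ := hG.exists_not_near N j c
  obtain ⟨e, he⟩ := hτ (max N' L)
  refine ⟨e 0, ⟨e, rfl, fun i => (le_max_right _ _).trans (he i)⟩, ?_⟩
  refine hiso (e 0) ((Finset.univ.erase 0).image e) ?_ ?_ ?_ ?_
  · have := (tight_image_iff (G' := G) (h := e) (S := Finset.univ.erase 0) (X := {0}) (G := τ)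
      e.injective.injOn (fun u _ v _ => e.map_adj_iff)).2 ht
    simpa using this
  · refine Finset.Nonempty.image ⟨⟨1, by omega⟩, ?_⟩ _
    simp [Fin.ext_iff]
  · refine Finset.card_image_le.trans ?_
    simp
  · intro v hv
    rw [Finset.mem_insert, Finset.mem_image] at hv
    rcases hv with rfl | ⟨i, -, rfl⟩
    · exact (le_max_left _ _).trans (he 0)
    · exact (le_max_left _ _).trans (he i)

/-- The vertices are chosen one after the other, each isolated from a segment that contains all the
earlier ones. -/
theorem exists_scattered {P : ℕ → Prop} (hP : ∀ N j, ∃ z, P z ∧ IsIsolated G j N z) (k N j : ℕ) :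
    ∃ F : Finset ℕ, F.card = k ∧ (∀ z ∈ F, P z ∧ IsIsolated G j N z) ∧
      ∀ z ∈ F, ∀ z' ∈ F, z ≠ z' → ¬ Near G j z z' := by
  induction k with
  | zero => exact ⟨∅, by simp⟩
  | succ k ih =>
    obtain ⟨F, hF, h1, h2⟩ := ih
    obtain ⟨z, hz, hzi⟩ := hP (max N (F.sup id + 1)) j
    have hlt : ∀ w ∈ F, w < max N (F.sup id + 1) := fun w hw => by
      have : id w ≤ F.sup id := Finset.le_sup hw
      simp only [id] at this
      omega
    have hzF : z ∉ F := fun h => hzi z (hlt z h) (Near.refl _ _)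
    refine ⟨insert z F, by rw [Finset.card_insert_of_notMem hzF, hF], ?_, ?_⟩
    · intro w hw
      rcases Finset.mem_insert.1 hw with rfl | hw
      · exact ⟨hz, hzi.mono le_rfl (le_max_left _ _)⟩
      · exact h1 w hw
    · intro w hw w' hw' hne
      rw [Finset.mem_insert] at hw hw'
      rcases hw with rfl | hw <;> rcases hw' with rfl | hw'
      · exact absurd rfl hne
      · exact fun hn => hzi w' (hlt w' hw') hn.symm
      · exact hzi w (hlt w hw)
      · exact h2 w hw w' hw' hne

end Infinite

/-! ### Transfer to finite initial segments -/

/-- The graph induced by `G` on the first `n` vertices. -/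
def initialGraph (G : SimpleGraph ℕ) (n : ℕ) : SimpleGraph (Fin n) := G.comap Fin.val

/-- The first `N` vertices. -/
def initialSegment (n N : ℕ) : Finset (Fin n) := Finset.univ.filter fun i => (i : ℕ) < N

section Initial

variable {G : SimpleGraph ℕ} {n N E : ℕ}

theorem mem_initialSegment {i : Fin n} : i ∈ initialSegment n N ↔ (i : ℕ) < N := by
  simp [initialSegment]

theorem image_initialSegment (h : N ≤ n) : (initialSegment n N).image Fin.val = Finset.range N := by
  ext v
  simp only [Finset.mem_image, mem_initialSegment, Finset.mem_range]
  exact ⟨fun ⟨i, hi, hiv⟩ => hiv ▸ hi, fun hv => ⟨⟨v, by omega⟩, hv, rfl⟩⟩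

theorem tight_initialGraph_iff {X S : Finset (Fin n)} :
    Tight (initialGraph G n) X S ↔ Tight G (X.image Fin.val) (S.image Fin.val) :=
  (tight_image_iff (G' := G) (h := Fin.val) Fin.val_injective.injOn fun _ _ _ _ => Iff.rfl).symm

theorem Near.of_initialGraph {r : ℕ} {a b : Fin n} (h : Near (initialGraph G n) r a b) :
    Near G r a b := by
  let f : initialGraph G n →g G := ⟨Fin.val, fun h => h⟩
  exact h.map f

theorem lt_of_tight_initialSegment {b : ℕ} (hN : N ≤ n)
    (hE : ∀ S, Tight G (Finset.range N) S → S.card ≤ b → S ⊆ Finset.range E)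
    {S : Finset (Fin n)} (hS : Tight (initialGraph G n) (initialSegment n N) S)
    (hb : S.card ≤ b) {v : Fin n} (hv : v ∈ S) : (v : ℕ) < E := by
  rw [tight_initialGraph_iff, image_initialSegment hN] at hS
  have := hE _ hS (Finset.card_image_le.trans hb) (Finset.mem_image_of_mem Fin.val hv)
  rwa [Finset.mem_range] at this

/-- A candidate that is not far lies within `(2 * s + 1) + (s + 1) = 3 * s + 2` of a pebble outside
`D`, since closure vertices not connected to such a pebble lie below `E`. There are fewer such
pebbles than candidates, and two candidates near the same pebble would be within `2 * (3 * s + 2)`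
of each other. -/
theorem exists_isFar {s k : ℕ} (hN : N ≤ n) (hNE : N ≤ E)
    (hE : ∀ S, Tight G (Finset.range N) S → S.card ≤ 2 * s + 1 → S ⊆ Finset.range E)
    {F : Finset ℕ} (hF : F.card = k) (hiso : ∀ z ∈ F, IsIsolated G (2 * (3 * s + 2)) E z)
    (hsep : ∀ z ∈ F, ∀ z' ∈ F, z ≠ z' → ¬ Near G (2 * (3 * s + 2)) z z') (hFn : ∀ z ∈ F, z < n)
    {X : Finset (Fin n)} (hX : initialSegment n N ⊆ X) (hk : (X \ initialSegment n N).card + 1 ≤ k) :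
    ∃ z, ∃ hz : z < n, z ∈ F ∧ IsFar (initialGraph G n) s X ⟨z, hz⟩ := by
  by_contra hcon
  push Not at hcon
  have hbad : ∀ z ∈ F, ∃ a ∈ (X \ initialSegment n N).image Fin.val, Near G (3 * s + 2) a z := by
    intro z hz
    have hnf := hcon z (hFn z hz) hz
    unfold IsFar at hnf
    push Not at hnf
    obtain ⟨x, hx, hxz⟩ := hnf
    have hxE : ¬ (x : ℕ) < E := fun hlt =>
      hiso z hz x hlt (hxz.of_initialGraph.mono (by omega))
    have hxD : x ∉ initialSegment n N := fun h => hxE ((mem_initialSegment.1 h).trans_le hNE)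
    rcases hx with hx | ⟨S, hS, hs, hxS⟩
    · exact ⟨x, Finset.mem_image_of_mem _ (Finset.mem_sdiff.2 ⟨hx, hxD⟩),
        hxz.of_initialGraph.mono (by omega)⟩
    · obtain ⟨Q, hQ, hQ1, -, hQ3⟩ := exists_component (initialGraph G n) S
        (X \ initialSegment n N)
      have hS' : Tight (initialGraph G n) ((X \ initialSegment n N) ∪ initialSegment n N) S := by
        rwa [Finset.sdiff_union_of_subset hX]
      by_cases hxQ : x ∈ Q
      · obtain ⟨a, ha, hax⟩ := hQ1 x hxQ
        exact ⟨a, Finset.mem_image_of_mem _ ha,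
          ((hax.mono hs).trans hxz).of_initialGraph.mono (by omega)⟩
      · exact absurd (lt_of_tight_initialSegment hN hE (hS'.sdiff_component hQ3)
          ((Finset.card_le_card Finset.sdiff_subset).trans hs) (by simp [hxS, hxQ])) hxE
  choose! a ha hnear using hbad
  obtain ⟨z, hz, z', hz', hne, heq⟩ := Finset.exists_ne_map_eq_of_card_lt_of_maps_to
    (s := F) (t := (X \ initialSegment n N).image Fin.val) (f := a)
    (Finset.card_image_le.trans_lt (by omega)) ha
  refine hsep z hz z' hz' hne ?_
  have := (hnear z hz).symm.trans (heq ▸ hnear z' hz')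
  exact this.mono (by omega)

theorem eventually_exists_embedding (hG : TightBounded G) {K k s c : ℕ} (hs : s ≤ K) (hc : c ≤ s)
    (hNE : N ≤ E)
    (hE : ∀ S, Tight G (Finset.range N) S → S.card ≤ 2 * K + 1 → S ⊆ Finset.range E)
    {τ : SimpleGraph (Fin (c + 1))} (hτ : IsRich G c τ) (hc1 : 1 ≤ c)
    (ht : Tight τ {0} (Finset.univ.erase 0)) :
    ∀ᶠ n in atTop, ∀ X, initialSegment n N ⊆ X → (X \ initialSegment n N).card + 1 ≤ k →
      ∃ e : τ ↪g initialGraph G n, (∀ i, Near (initialGraph G n) s (e 0) (e i)) ∧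
        IsFar (initialGraph G n) s X (e 0) := by
  obtain ⟨F, hF, hFi, hsep⟩ := exists_scattered (hτ.exists_isolated hG ht hc1 E) k E
    (2 * (3 * s + 2))
  have hev : ∀ z ∈ F, ∀ᶠ n in atTop,
      ∃ e : τ ↪g G, e 0 = z ∧ (∀ i, E ≤ e i) ∧ ∀ i, e i < n := by
    intro z hz
    obtain ⟨e, he0, he⟩ := (hFi z hz).1
    filter_upwards [eventually_all.2 fun i => eventually_gt_atTop (e i)] with n hn
    exact ⟨e, he0, he, hn⟩
  filter_upwards [eventually_ge_atTop N, (eventually_all_finset F).2 hev] with n hN hn X hX hk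
  obtain ⟨z, hz, hzF, hfar⟩ := exists_isFar hN hNE
    (fun S hS hb => hE S hS (by omega)) hF (fun z hz => (hFi z hz).2) hsep
    (fun z hz => by obtain ⟨e, he0, -, he⟩ := hn z hz; exact he0 ▸ he 0) hX hk
  obtain ⟨e, he0, heE, hen⟩ := hn z hzF
  let e' : τ ↪g initialGraph G n := ⟨⟨fun i => ⟨e i, hen i⟩, fun i j hij =>
    e.injective (congrArg Fin.val hij)⟩, e.map_rel_iff⟩
  have he'0 : e' 0 = ⟨z, hz⟩ := Fin.ext he0
  refine ⟨e', ?_, by rwa [he'0]⟩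
  set S := (Finset.univ.erase (0 : Fin (c + 1))).image e' with hS
  have hSt : Tight (initialGraph G n) ({e' 0} ∪ ∅) S := by
    have := (tight_image_iff (G' := initialGraph G n) (h := e') (S := Finset.univ.erase 0)
      (X := {0}) (G := τ) e'.injective.injOn (fun u _ v _ => e'.map_adj_iff)).2 ht
    simpa using this
  have hSc : S.card ≤ c := by
    refine Finset.card_image_le.trans ?_
    simp
  obtain ⟨Q, hQ, hQ1, -, hQ3⟩ := exists_component (initialGraph G n) S {e' 0}
  -- The part of the copy that is not connected to its root is tight over `∅`, hence over the
  -- initial segment. It would lie below `E`, whereas the copy was taken beyond `E`.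
  have hSQ := (hSt.sdiff_component hQ3).mono (Finset.empty_subset (initialSegment n N))
  intro i
  by_cases hi : i = 0
  · rw [hi]; exact Near.refl _ _
  have hiS : e' i ∈ S := Finset.mem_image_of_mem _ (by simp [hi])
  by_cases hiQ : e' i ∈ Q
  · obtain ⟨a, ha, hai⟩ := hQ1 _ hiQ
    rw [Finset.mem_singleton.1 ha] at hai
    exact hai.mono (by omega)
  · have hEi : E ≤ (e' i : ℕ) := heE i
    have : e' i ∉ initialSegment n N := fun h => by
      have := mem_initialSegment.1 h
      omega
    have := lt_of_tight_initialSegment hN hE hSQ ((Finset.card_le_card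
      (Finset.sdiff_subset.trans Finset.sdiff_subset)).trans (by omega)) (v := e' i)
      (by simp [hiS, hiQ, this])
    omega

theorem eventually_exists_treelike (hG : TightBounded G)
    (hinf : ∀ v N : ℕ, ∃ w, N ≤ w ∧ G.Adj v w) {K k s : ℕ} (hs : s ≤ K) (hNE : N ≤ E)
    (hE : ∀ S, Tight G (Finset.range N) S → S.card ≤ 2 * K + 1 → S ⊆ Finset.range E) :
    ∀ᶠ n in atTop, ∀ X, initialSegment n N ⊆ X → (X \ initialSegment n N).card + 1 ≤ k →
      ∃ y, IsFar (initialGraph G n) s X y ∧ ∀ S, Tight (initialGraph G n) {y} S → S.card ≤ s →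
        (∀ v ∈ S, Near (initialGraph G n) s y v) → S = ∅ := by
  obtain ⟨F, hF, hFi, hsep⟩ := exists_scattered (hG.exists_isolated_treelike hinf s) k E
    (2 * (3 * s + 2))
  filter_upwards [eventually_ge_atTop N,
    (eventually_all_finset F).2 fun z _ => eventually_gt_atTop z] with n hN hn X hX hk
  obtain ⟨z, hz, hzF, hfar⟩ := exists_isFar hN hNE
    (fun S hS hb => hE S hS (by omega)) hF (fun z hz => (hFi z hz).2) hsep hn hX hk
  refine ⟨⟨z, hz⟩, hfar, fun S hS hs hn => ?_⟩
  rw [tight_initialGraph_iff, Finset.image_singleton] at hS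
  have := (hFi z hzF).1 (S.image Fin.val) hS (Finset.card_image_le.trans hs) (by
    intro v hv
    obtain ⟨u, hu, rfl⟩ := Finset.mem_image.1 hv
    exact (hn u hu).of_initialGraph)
  simpa using this

theorem eventually_exists_fresh {K k m : ℕ} (hinf : ∀ v, {w | G.Adj v w}.Infinite)
    (hback : ∀ v, m ≤ v → ∃ Y ⊆ Finset.range v, Y.card = m ∧ ∀ y ∈ Y, G.Adj v y) (hk : k + 2 ≤ m)
    (hNE : N ≤ E) (hmE : m ≤ E)
    (hE : ∀ S, Tight G (Finset.range N) S → S.card ≤ (k + 2) * K + k → S ⊆ Finset.range E) :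
    ∀ᶠ n in atTop, ∀ X, initialSegment n N ⊆ X → (X \ initialSegment n N).card ≤ k → ∀ x ∈ X,
      ∃ y, (initialGraph G n).Adj x y ∧ y ∉ tightClosure (initialGraph G n) K X := by
  -- One more neighbour than the bound of `card_le_of_subset_tightClosure` on subsets of the
  -- closure.
  choose Y hY hYc using fun v => (hinf v).exists_subset_card_eq (E + k + k * K + 1)
  filter_upwards [eventually_ge_atTop E, (eventually_all_finset (Finset.range E)).2 fun v _ =>
    (eventually_all_finset (Y v)).2 fun w _ => eventually_gt_atTop w] with n hEn hn X hX hXk x hx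
  have hcE : (initialSegment n E).card = E := by
    rw [← Finset.card_image_of_injective _ Fin.val_injective, image_initialSegment hEn,
      Finset.card_range]
  refine exists_adj_notMem_tightClosure (D := initialSegment n N) (E := initialSegment n E)
    (k := k) (u := K) hX hXk ?_ ?_ ?_ ?_ hx
  · intro i hi
    rw [mem_initialSegment] at hi ⊢
    omega
  · intro S hS hb v hv
    rw [mem_initialSegment]
    exact lt_of_tight_initialSegment (hNE.trans hEn) hE hS hb hv
  · intro v hv
    have hv' := Finset.mem_range.2 (mem_initialSegment.1 hv)
    refine ⟨(Y v).attachFin (hn v hv'), ?_, ?_⟩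
    · rw [Finset.card_attachFin, hYc, hcE]
      omega
    · intro y hy
      rw [Finset.mem_attachFin] at hy
      exact hY v hy
  · intro v hv
    rw [mem_initialSegment, not_lt] at hv
    obtain ⟨T, hT, hTc, hTa⟩ := hback v (by omega)
    obtain ⟨T', hT', hTc'⟩ := Finset.exists_subset_card_eq (s := T) (n := k + 2) (by omega)
    refine ⟨T'.attachFin fun w hw => (Finset.mem_range.1 (hT (hT' hw))).trans v.2, ?_, ?_⟩
    · rw [Finset.card_attachFin, hTc']
    · intro y hy
      rw [Finset.mem_attachFin] at hy
      exact hTa y (hT' hy)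

theorem exists_eventually_isHomogeneous {k m : ℕ} (hG : TightBounded G)
    (hinf : ∀ v, {w | G.Adj v w}.Infinite)
    (hback : ∀ v, m ≤ v → ∃ Y ⊆ Finset.range v, Y.card = m ∧ ∀ y ∈ Y, G.Adj v y) (hk : k + 2 ≤ m)
    (K : ℕ) : ∃ N, 1 ≤ N ∧ ∀ᶠ n in atTop,
      IsHomogeneous (initialGraph G n) (initialSegment n N) k K (IsRich G) := by
  have hinf' : ∀ v N : ℕ, ∃ w, N ≤ w ∧ G.Adj v w := by
    intro v N
    obtain ⟨w, hw, hwN⟩ := (hinf v).exists_gt N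
    exact ⟨w, hwN.le, hw⟩
  -- There are finitely many types of size at most `K`, and copies of a type that is not rich all
  -- meet some initial segment. A single `N` serves for all of them.
  have hpoor : ∀ᶠ N in atTop, ∀ c ∈ Set.Iic K, ∀ τ : SimpleGraph (Fin (c + 1)),
      ¬ IsRich G c τ → ∀ e : τ ↪g G, ∃ i, e i < N := by
    refine (eventually_all_finite (Set.finite_Iic K)).2 fun c _ => eventually_all.2 fun τ => ?_
    by_cases h : IsRich G c τ
    · exact Eventually.of_forall fun N h' => absurd h h'
    · have h' := h
      unfold IsRich at h'
      push Not at h'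
      obtain ⟨N₀, hN₀⟩ := h'
      filter_upwards [eventually_ge_atTop N₀] with N hN _ e
      obtain ⟨i, hi⟩ := hN₀ e
      exact ⟨i, by omega⟩
  obtain ⟨N, hN, hN1⟩ := (hpoor.and (eventually_ge_atTop 1)).exists
  obtain ⟨B₁, hB₁⟩ := hG N ((k + 2) * K + k)
  obtain ⟨B₂, hB₂⟩ := hG N (2 * K + 1)
  set E := max (max N m) (max B₁ B₂) with hE
  have hE₁ : ∀ S, Tight G (Finset.range N) S → S.card ≤ (k + 2) * K + k → S ⊆ Finset.range E :=
    fun S hS hb => (hB₁ S hS hb).trans (Finset.range_subset_range.2 (by omega))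
  have hE₂ : ∀ S, Tight G (Finset.range N) S → S.card ≤ 2 * K + 1 → S ⊆ Finset.range E :=
    fun S hS hb => (hB₂ S hS hb).trans (Finset.range_subset_range.2 (by omega))
  refine ⟨N, hN1, ?_⟩
  have h1 : ∀ᶠ n in atTop, ∀ s ∈ Set.Iic K, ∀ c ∈ Set.Iic s, ∀ τ : SimpleGraph (Fin (c + 1)),
      IsRich G c τ → 1 ≤ c → Tight τ {0} (Finset.univ.erase 0) →
        ∀ X, initialSegment n N ⊆ X → (X \ initialSegment n N).card + 1 ≤ k →
          ∃ e : τ ↪g initialGraph G n, (∀ i, Near (initialGraph G n) s (e 0) (e i)) ∧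
            IsFar (initialGraph G n) s X (e 0) := by
    refine (eventually_all_finite (Set.finite_Iic K)).2 fun s hs =>
      (eventually_all_finite (Set.finite_Iic s)).2 fun c hc => eventually_all.2 fun τ => ?_
    by_cases h : IsRich G c τ ∧ 1 ≤ c ∧ Tight τ {0} (Finset.univ.erase 0)
    · filter_upwards [eventually_exists_embedding (k := k) hG hs hc (by omega : N ≤ E) hE₂ h.1 h.2.1
        h.2.2] with n hn _ _ _ using hn
    · exact Eventually.of_forall fun n a b d => absurd ⟨a, b, d⟩ h
  have h2 := (eventually_all_finite (Set.finite_Iic K)).2 fun s hs =>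
    eventually_exists_treelike (k := k) hG hinf' (Set.mem_Iic.1 hs) (by omega : N ≤ E) hE₂
  filter_upwards [h1, h2, eventually_exists_fresh (K := K) hinf hback hk (by omega : N ≤ E)
    (by omega) hE₁] with n h1 h2 h3
  refine ⟨h3, ?_, fun s hs c hc τ => h1 s hs c hc τ, h2⟩
  intro c hc τ e he
  by_contra hr
  let f : initialGraph G n ↪g G := ⟨⟨Fin.val, Fin.val_injective⟩, Iff.rfl⟩
  obtain ⟨i, hi⟩ := hN c hc τ hr (e.trans f)
  exact he i (mem_initialSegment.2 hi)

theorem image_tightClosure_initialGraph {B t : ℕ} (hN : N ≤ n) (hBn : B ≤ n)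
    (hB : ∀ S, Tight G (Finset.range N) S → S.card ≤ t → S ⊆ Finset.range B) :
    Fin.val '' tightClosure (initialGraph G n) t (initialSegment n N) =
      tightClosure G t (Finset.range N) := by
  apply Set.Subset.antisymm
  · rintro _ ⟨v, hv | ⟨S, hS, ht, hv⟩, rfl⟩
    · exact Or.inl (Finset.mem_range.2 (mem_initialSegment.1 hv))
    · rw [tight_initialGraph_iff, image_initialSegment hN] at hS
      exact Or.inr ⟨_, hS, Finset.card_image_le.trans ht, Finset.mem_image_of_mem _ hv⟩
  · rintro v (hv | ⟨S, hS, ht, hv⟩)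
    · rw [Finset.mem_range] at hv
      exact ⟨⟨v, by omega⟩, Or.inl (mem_initialSegment.2 hv), rfl⟩
    · have hSn : ∀ w ∈ S, w < n := fun w hw =>
        (Finset.mem_range.1 (hB S hS ht hw)).trans_le hBn
      refine ⟨⟨v, hSn v hv⟩, Or.inr ⟨S.attachFin hSn, ?_, by rwa [Finset.card_attachFin],
        by simpa [Finset.mem_attachFin] using hv⟩, rfl⟩
      rw [tight_initialGraph_iff, image_initialSegment hN]
      convert hS
      ext w
      simp only [Finset.mem_image, Finset.mem_attachFin]
      exact ⟨fun ⟨i, hi, hiw⟩ => hiw ▸ hi, fun hw => ⟨⟨w, hSn w hw⟩, hw, rfl⟩⟩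

theorem exists_isPosition_initialGraph {B t n' : ℕ} (hN1 : 1 ≤ N) (hN : N ≤ n) (hN' : N ≤ n')
    (hBn : B ≤ n) (hBn' : B ≤ n')
    (hB : ∀ S, Tight G (Finset.range N) S → S.card ≤ t → S ⊆ Finset.range B) :
    ∃ h : Fin n → Fin n', (∀ i : Fin n, (i : ℕ) < N → (h i : ℕ) = i) ∧
      IsPosition (initialGraph G n) (initialGraph G n') t (initialSegment n N)
        (initialSegment n' N) h := by
  have e1 := image_tightClosure_initialGraph hN hBn hB
  have e2 := image_tightClosure_initialGraph hN' hBn' hB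
  -- The identity where possible. The value `0` elsewhere is irrelevant, because the closure of the
  -- initial segment lies below both `n` and `n'`.
  set h : Fin n → Fin n' := fun i => if hi : (i : ℕ) < n' then ⟨i, hi⟩ else ⟨0, by omega⟩ with hh
  have hv : ∀ i : Fin n, (i : ℕ) < n' → (h i : ℕ) = i := fun i hi => by simp [hh, hi]
  have hcl : ∀ i ∈ tightClosure (initialGraph G n) t (initialSegment n N), (h i : ℕ) = i := by
    intro i hi
    have : (i : ℕ) ∈ tightClosure G t (Finset.range N) := e1 ▸ Set.mem_image_of_mem _ hi
    rw [← e2] at this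
    obtain ⟨i', -, hi'⟩ := this
    exact hv i (hi' ▸ i'.2)
  refine ⟨h, fun i hi => hv i (by omega), ?_, ?_, ?_, ?_⟩
  · intro i hi j hj hij
    exact Fin.ext (by rw [← hcl i hi, ← hcl j hj, hij])
  · apply Set.image_injective.2 Fin.val_injective
    rw [Set.image_image, e2, ← e1]
    exact Set.image_congr hcl
  · intro i hi j hj
    change G.Adj _ _ ↔ G.Adj _ _
    rw [hcl i hi, hcl j hj]
  · apply Finset.image_injective Fin.val_injective
    rw [Finset.image_image, image_initialSegment hN', ← image_initialSegment hN]
    exact Finset.image_congr fun i hi => hcl i (Or.inl hi)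

end Initial

/-! ### Stabilisation of the truth value -/

theorem GraphFormula.sat_congr {V : Type*} (G : SimpleGraph V) (φ : GraphFormula) {v v' : ℕ → V}
    (h : ∀ x ∈ φ.freeVars, v x = v' x) : φ.Sat G v ↔ φ.Sat G v' := by
  induction φ generalizing v v' with
  | eq x y | adj x y =>
    simp only [Sat]
    rw [h x (by simp [freeVars]), h y (by simp [freeVars])]
  | neg φ ih =>
    have := ih h
    simp only [Sat, this]
  | conj φ ψ ih₁ ih₂ | disj φ ψ ih₁ ih₂ | imp φ ψ ih₁ ih₂ | bicond φ ψ ih₁ ih₂ =>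
    simp only [freeVars, Finset.mem_union] at h
    have h₁ := ih₁ fun x hx => h x (Or.inl hx)
    have h₂ := ih₂ fun x hx => h x (Or.inr hx)
    simp only [Sat, h₁, h₂]
  | all x φ ih | ex x φ ih =>
    have key : ∀ a, φ.Sat G (Function.update v x a) ↔ φ.Sat G (Function.update v' x a) := by
      intro a
      refine ih fun z hz => ?_
      by_cases hzx : z = x
      · subst hzx; simp
      · rw [Function.update_of_ne hzx, Function.update_of_ne hzx]
        exact h z (by simp [freeVars, hz, hzx])
    simp only [Sat, key]

theorem GraphFormula.IsSentence.models_iff {V : Type*} {G : SimpleGraph V} {φ : GraphFormula}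
    (hφ : φ.IsSentence) (v : ℕ → V) : G.Models φ ↔ φ.Sat G v := by
  refine ⟨fun h => h v, fun h v' => (φ.sat_congr G ?_).1 h⟩
  intro x hx
  rw [show φ.freeVars = ∅ from hφ] at hx
  simp at hx

/-- The truth value of a sentence with at most `m - 2` variables in the graph on the first `n`
vertices is eventually constant. -/
theorem eventually_models_iff {G : SimpleGraph ℕ} {m : ℕ} (hG : TightBounded G)
    (hinf : ∀ v, {w | G.Adj v w}.Infinite)
    (hback : ∀ v, m ≤ v → ∃ Y ⊆ Finset.range v, Y.card = m ∧ ∀ y ∈ Y, G.Adj v y)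
    {φ : GraphFormula} (hφ : φ.IsSentence) (hvars : φ.vars.card + 2 ≤ m) :
    ∃ n₀, ∀ n ≥ n₀, ((initialGraph G n).Models φ ↔ (initialGraph G n₀).Models φ) := by
  obtain ⟨N, hN1, hhom⟩ := exists_eventually_isHomogeneous hG hinf hback hvars φ.level
  obtain ⟨B, hB⟩ := hG N φ.level
  obtain ⟨n₀, hn₀⟩ := eventually_atTop.1 (hhom.and (eventually_ge_atTop (max N B)))
  refine ⟨n₀, fun n hn => ?_⟩
  obtain ⟨hh, hb⟩ := hn₀ n hn
  obtain ⟨hh₀, hb₀⟩ := hn₀ n₀ le_rfl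
  obtain ⟨h, hhv, H⟩ := exists_isPosition_initialGraph hN1 (by omega : N ≤ n) (by omega : N ≤ n₀)
    (by omega) (by omega) hB
  -- All variables start at the vertex `0`, which lies in the initial segment, so the initial
  -- position has no pebble outside it.
  have hzero : ∀ {n : ℕ} (h0 : 0 < n), initialSegment n N ∪
      φ.vars.image (fun _ => (⟨0, h0⟩ : Fin n)) = initialSegment n N := by
    intro n h0
    refine Finset.union_eq_left.2 fun i hi => ?_
    obtain ⟨_, -, rfl⟩ := Finset.mem_image.1 hi
    exact mem_initialSegment.2 hN1
  rw [hφ.models_iff fun _ => (⟨0, by omega⟩ : Fin n),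
    hφ.models_iff fun _ => (⟨0, by omega⟩ : Fin n₀)]
  refine φ.sat_iff_of_isPosition subset_rfl le_rfl hh hh₀ H.image_base (h := h) ?_ ?_
  · intro z _
    exact Fin.ext (hhv ⟨0, by omega⟩ hN1).symm
  · rw [hzero, hzero]
    exact H

/-! ### Estimates for the expected number of tight sets -/

section Counting

/-- Equivalently, `β` given vertices all belong to a random `m`-subset with probability at most `(m
/ n) ^ β`. -/
theorem choose_sub_mul_pow_le {n m : ℕ} (hmn : m ≤ n) {β : ℕ} (hβ : β ≤ m) :
    (n - β).choose (m - β) * n ^ β ≤ m ^ β * n.choose m := by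
  induction β with
  | zero => simp
  | succ β ih =>
    obtain ⟨q, hq⟩ : ∃ q, m - β = q + 1 := ⟨m - β - 1, by omega⟩
    obtain ⟨p, hp⟩ : ∃ p, n - β = p + 1 := ⟨n - β - 1, by omega⟩
    have ih := ih (by omega)
    rw [show n - (β + 1) = p by omega, show m - (β + 1) = q by omega]
    rw [hp, hq] at ih
    have h1 := Nat.add_one_mul_choose_eq p q
    have h2 : (q + 1) * n ≤ m * (p + 1) := by
      have e1 : m = q + 1 + β := by omega
      have e2 : n = p + 1 + β := by omega
      have h3 : q ≤ p := by omega
      rw [e1, e2]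
      nlinarith [Nat.mul_le_mul_right β h3]
    have h4 : p.choose q * n ≤ m * (p + 1).choose (q + 1) := by
      refine Nat.le_of_mul_le_mul_left ?_ (Nat.succ_pos p)
      calc (p + 1) * (p.choose q * n) = (p + 1).choose (q + 1) * ((q + 1) * n) := by
            rw [← mul_assoc, h1, mul_assoc]
        _ ≤ (p + 1).choose (q + 1) * (m * (p + 1)) := Nat.mul_le_mul_left _ h2
        _ = (p + 1) * (m * (p + 1).choose (q + 1)) := by ring
    calc p.choose q * n ^ (β + 1) = p.choose q * n * n ^ β := by ring
      _ ≤ m * (p + 1).choose (q + 1) * n ^ β := Nat.mul_le_mul_right _ h4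
      _ = m * ((p + 1).choose (q + 1) * n ^ β) := by ring
      _ ≤ m * (m ^ β * n.choose m) := Nat.mul_le_mul_left _ ih
      _ = m ^ (β + 1) * n.choose m := by ring

/-- Surplus exponents at late vertices pay for early vertices with few back edges. The spare power
of `y` carries the surplus down in the induction on the least element, where `y` becomes `a + 1`;
the one extra factor can be kept at the largest vertex. -/
theorem prod_mul_le_prod_pow (S : Finset ℕ) (b : ℕ → ℕ)
    (h : ∀ t ∈ S, (S.filter (t ≤ ·)).card + 1 ≤ ∑ v ∈ S.filter (t ≤ ·), b v) :
    ∀ y : ℕ, (∀ v ∈ S, y ≤ v + 1) → ∀ u ∈ S,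
      (u + 1) * (∏ v ∈ S, (v + 1)) * y ^ (∑ v ∈ S, b v - S.card - 1) ≤ ∏ v ∈ S, (v + 1) ^ b v := by
  induction S using Finset.induction_on_min with
  | empty => simp
  | insert a s ha ih =>
    intro y hy u hu
    have has : a ∉ s := fun h => lt_irrefl _ (ha a h)
    have hfa : (insert a s).filter (a ≤ ·) = insert a s := by
      refine Finset.filter_true_of_mem fun v hv => ?_
      rcases Finset.mem_insert.1 hv with rfl | hv
      · exact le_rfl
      · exact (ha v hv).le
    have h0 := h a (by simp)
    rw [hfa, Finset.card_insert_of_notMem has, Finset.sum_insert has] at h0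
    have hya := hy a (by simp)
    rw [Finset.prod_insert has, Finset.prod_insert has, Finset.sum_insert has,
      Finset.card_insert_of_notMem has]
    rcases s.eq_empty_or_nonempty with rfl | hne
    · simp only [Finset.card_empty, Finset.sum_empty, Finset.prod_empty] at h0 ⊢
      have : u = a := by simpa using hu
      subst this
      obtain ⟨d, hd⟩ : ∃ d, b u = d + 2 := ⟨b u - 2, by omega⟩
      rw [hd, show d + 2 + 0 - (0 + 1) - 1 = d by omega]
      calc (u + 1) * ((u + 1) * 1) * y ^ d ≤ (u + 1) * ((u + 1) * 1) * (u + 1) ^ d :=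
            Nat.mul_le_mul_left _ (Nat.pow_le_pow_left hya d)
        _ = (u + 1) ^ (d + 2) * 1 := by ring
    · have hfs : ∀ t ∈ s, (insert a s).filter (t ≤ ·) = s.filter (t ≤ ·) := by
        intro t ht
        rw [Finset.filter_insert, if_neg (by have := ha t ht; omega)]
      have hs : ∀ t ∈ s, (s.filter (t ≤ ·)).card + 1 ≤ ∑ v ∈ s.filter (t ≤ ·), b v := by
        intro t ht
        have := h t (by simp [ht])
        rwa [hfs t ht] at this
      have hmin : s.card + 1 ≤ ∑ v ∈ s, b v := by
        have := hs _ (s.min'_mem hne)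
        rwa [Finset.filter_true_of_mem fun v hv => s.min'_le v hv] at this
      obtain ⟨u', hu', huu'⟩ : ∃ u' ∈ s, u ≤ u' := by
        rcases Finset.mem_insert.1 hu with rfl | hu
        · obtain ⟨u', hu'⟩ := hne
          exact ⟨u', hu', (ha u' hu').le⟩
        · exact ⟨u, hu, le_rfl⟩
      have key := ih hs (a + 1) (fun v hv => by have := ha v hv; omega) u' hu'
      obtain ⟨d, hd⟩ : ∃ d, b a + ∑ v ∈ s, b v = s.card + 2 + d := ⟨_, (Nat.add_sub_of_le h0).symm⟩
      have e1 : b a + (∑ v ∈ s, b v - s.card - 1) = d + 1 := by omega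
      rw [show b a + ∑ v ∈ s, b v - (s.card + 1) - 1 = d by omega]
      calc (u + 1) * ((a + 1) * ∏ v ∈ s, (v + 1)) * y ^ d
          ≤ (u' + 1) * ((a + 1) * ∏ v ∈ s, (v + 1)) * (a + 1) ^ d :=
            Nat.mul_le_mul (Nat.mul_le_mul_right _ (by omega)) (Nat.pow_le_pow_left hya d)
        _ = (u' + 1) * (∏ v ∈ s, (v + 1)) * (a + 1) ^ (d + 1) := by ring
        _ = (a + 1) ^ b a * ((u' + 1) * (∏ v ∈ s, (v + 1)) *
              (a + 1) ^ (∑ v ∈ s, b v - s.card - 1)) := by rw [← e1, pow_add]; ring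
        _ ≤ (a + 1) ^ b a * ∏ v ∈ s, (v + 1) ^ b v := Nat.mul_le_mul_left _ key

/-- If all final segments of `S` meet more edges than they have vertices, the expected number of
copies is summable. -/
theorem prod_inv_pow_le {S : Finset ℕ} {b : ℕ → ℕ} {B : ℕ} (hne : S.Nonempty) (hB : S.card ≤ B)
    (h : ∀ t ∈ S, (S.filter (t ≤ ·)).card + 1 ≤ ∑ v ∈ S.filter (t ≤ ·), b v) :
    ∏ v ∈ S, (((v : ℝ) + 1) ^ b v)⁻¹ ≤ ∏ v ∈ S, ((v : ℝ) + 1) ^ (-(1 + 1 / (B : ℝ))) := by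
  have hBpos : 0 < B := hne.card_pos.trans_le hB
  have key := prod_mul_le_prod_pow S b h 1 (by simp) (S.max' hne) (S.max'_mem hne)
  rw [one_pow, mul_one] at key
  have hkey : ((S.max' hne : ℝ) + 1) * ∏ v ∈ S, ((v : ℝ) + 1) ≤ ∏ v ∈ S, ((v : ℝ) + 1) ^ b v := by
    exact_mod_cast key
  -- The extra factor at the maximum is shared equally: each of the at most `B` vertices receives
  -- the exponent `1 / B`.
  have hM : ∏ v ∈ S, ((v : ℝ) + 1) ^ (1 / (B : ℝ)) ≤ (S.max' hne : ℝ) + 1 := by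
    calc ∏ v ∈ S, ((v : ℝ) + 1) ^ (1 / (B : ℝ))
        ≤ ∏ v ∈ S, ((S.max' hne : ℝ) + 1) ^ (1 / (B : ℝ)) := by
          refine Finset.prod_le_prod (fun v _ => by positivity) fun v hv => ?_
          refine Real.rpow_le_rpow (by positivity) ?_ (by positivity)
          have : (v : ℝ) ≤ S.max' hne := by exact_mod_cast S.le_max' v hv
          linarith
      _ = ((S.max' hne : ℝ) + 1) ^ ((S.card : ℝ) / B) := by
          rw [Finset.prod_const, ← Real.rpow_natCast, ← Real.rpow_mul (by positivity)]
          congr 1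
          ring
      _ ≤ ((S.max' hne : ℝ) + 1) ^ (1 : ℝ) := by
          refine Real.rpow_le_rpow_of_exponent_le (by simp) ?_
          rw [div_le_one (by exact_mod_cast hBpos)]
          exact_mod_cast hB
      _ = _ := Real.rpow_one _
  have e : ∏ v ∈ S, ((v : ℝ) + 1) ^ (-(1 + 1 / (B : ℝ))) =
      ((∏ v ∈ S, ((v : ℝ) + 1) ^ (1 / (B : ℝ))) * ∏ v ∈ S, ((v : ℝ) + 1))⁻¹ := by
    rw [← Finset.prod_mul_distrib, ← Finset.prod_inv_distrib]
    refine Finset.prod_congr rfl fun v _ => ?_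
    rw [Real.rpow_neg (by positivity), Real.rpow_add (by positivity), Real.rpow_one, mul_comm]
  rw [e, Finset.prod_inv_distrib]
  refine inv_anti₀ ?_ (le_trans ?_ hkey)
  · exact mul_pos (Finset.prod_pos fun v _ => by positivity)
      (Finset.prod_pos fun v _ => by positivity)
  · exact mul_le_mul_of_nonneg_right hM (Finset.prod_nonneg fun v _ => by positivity)

/-- The set `S` lies after `range N`, so every edge that meets a final segment of `S` has its later
endpoint in that segment and is counted there as a back edge. -/
theorem card_tight_filter_lt_sum {G : SimpleGraph ℕ} {N : ℕ} {S : Finset ℕ}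
    (hS : Tight G (Finset.range N) S) [∀ v, DecidablePred (G.Adj v)] {t : ℕ} (ht : t ∈ S) :
    (S.filter (t ≤ ·)).card + 1 ≤ ∑ v ∈ S.filter (t ≤ ·),
      ((S ∪ Finset.range N).filter fun w => w < v ∧ G.Adj v w).card := by
  classical
  set T := S ∪ Finset.range N with hT
  set U := S.filter (t ≤ ·) with hU
  have h1 := hS.2 U (Finset.filter_subset _ _) ⟨t, by simp [hU, ht]⟩
  rw [← hT] at h1
  set P := U.sigma fun v => T.filter fun w => w < v ∧ G.Adj v w with hP
  have hup : ∀ a ∈ U, ∀ b ∈ T, a < b → b ∈ U := by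
    intro a ha b hb hab
    rw [hU, Finset.mem_filter] at ha ⊢
    have haN : N ≤ a := by
      by_contra hlt
      exact Finset.disjoint_left.1 hS.1 ha.1 (Finset.mem_range.2 (by omega))
    rw [hT, Finset.mem_union, Finset.mem_range] at hb
    exact ⟨hb.resolve_right (by omega), by omega⟩
  have h2 : dartCount G T U ≤
      (P.image (fun p => (p.1, p.2)) ∪ P.image (fun p => (p.2, p.1))).card := by
    refine Finset.card_le_card ?_
    rintro ⟨a, b⟩ hp
    simp only [Finset.mem_filter, Finset.mem_product] at hp
    obtain ⟨⟨ha, hb⟩, hab, hab'⟩ := hp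
    simp only [Finset.mem_union, Finset.mem_image, hP, Finset.mem_sigma, Finset.mem_filter]
    rcases lt_or_gt_of_ne hab.ne with hlt | hlt
    · right
      refine ⟨⟨b, a⟩, ⟨?_, ha, hlt, hab.symm⟩, rfl⟩
      rcases hab' with h | h
      · exact hup a h b hb hlt
      · exact h
    · left
      refine ⟨⟨a, b⟩, ⟨?_, hb, hlt, hab⟩, rfl⟩
      rcases hab' with h | h
      · exact h
      · exact hup b h a ha hlt
  have h3 := h2.trans ((Finset.card_union_le _ _).trans
    (add_le_add Finset.card_image_le Finset.card_image_le))
  rw [hP, Finset.card_sigma] at h3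
  omega

end Counting

/-! ### The law of a single choice -/

instance (m k : ℕ) : MeasurableSingletonClass (AttachmentChoice m k) := ⟨fun _ => trivial⟩

section Choice

theorem card_attachmentChoice (m k : ℕ) :
    Fintype.card (AttachmentChoice m k) = (m + k).choose m := by
  have := Fintype.card_finset_len (α := Fin (m + k)) m
  rw [Fintype.card_fin] at this
  rw [← this]
  rfl

/-- The law of a choice. -/
noncomputable def choiceMeasure (m k : ℕ) : Measure (AttachmentChoice m k) :=
  (PMF.uniformOfFintype (AttachmentChoice m k)).toMeasure

instance (m k : ℕ) : IsProbabilityMeasure (choiceMeasure m k) :=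
  inferInstanceAs (IsProbabilityMeasure (PMF.toMeasure _))

theorem choiceMeasure_le {m k : ℕ} {A : Set (AttachmentChoice m k)} {c : ℕ} {r : ℝ}
    (f : AttachmentChoice m k → Finset (Fin (m + k))) (T : Finset (Finset (Fin (m + k))))
    (hf : Set.MapsTo f A T) (hinj : Set.InjOn f A) (hT : T.card ≤ c)
    (hr : (c : ℝ) ≤ r * (m + k).choose m) : choiceMeasure m k A ≤ ENNReal.ofReal r := by
  classical
  have hA : Fintype.card A ≤ c := by
    rw [← Set.toFinset_card]
    refine (Finset.card_le_card_of_injOn f ?_ ?_).trans hT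
    · intro x hx
      exact hf (by simpa using hx)
    · intro x hx y hy
      exact hinj (by simpa using hx) (by simpa using hy)
  have hpos : 0 < (m + k).choose m := Nat.choose_pos (by omega)
  rw [choiceMeasure, PMF.toMeasure_uniformOfFintype_apply _ (Set.toFinite A).measurableSet,
    card_attachmentChoice]
  have e : ((Fintype.card A : ℕ) : ENNReal) / ((m + k).choose m : ℕ) =
      ENNReal.ofReal ((Fintype.card A : ℝ) / (m + k).choose m) := by
    rw [ENNReal.ofReal_div_of_pos (by exact_mod_cast hpos), ENNReal.ofReal_natCast,
      ENNReal.ofReal_natCast]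
  rw [e]
  refine ENNReal.ofReal_le_ofReal ?_
  rw [div_le_iff₀ (by exact_mod_cast hpos)]
  exact le_trans (by exact_mod_cast hA) hr

theorem choiceMeasure_superset_le {m k : ℕ} (hm : 0 < m) (B : Finset (Fin (m + k))) :
    choiceMeasure m k {s | B ⊆ s.1} ≤ ENNReal.ofReal (((m : ℝ) / (m + k)) ^ B.card) := by
  by_cases hB : B.card ≤ m
  · refine choiceMeasure_le (fun s => s.1 \ B)
      (Finset.powersetCard (m - B.card) (Finset.univ \ B)) ?_ ?_ (c := (m + k - B.card).choose
        (m - B.card)) ?_ ?_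
    · intro s hs
      rw [Finset.mem_coe, Finset.mem_powersetCard]
      refine ⟨Finset.sdiff_subset_sdiff (Finset.subset_univ _) subset_rfl, ?_⟩
      rw [Finset.card_sdiff_of_subset hs, s.2]
    · intro s hs s' hs' h
      refine Subtype.ext ?_
      rw [← Finset.sdiff_union_of_subset (show B ⊆ s.1 from hs),
        ← Finset.sdiff_union_of_subset (show B ⊆ s'.1 from hs')]
      exact congrArg (· ∪ B) h
    · rw [Finset.card_powersetCard, Finset.card_sdiff_of_subset (Finset.subset_univ _)]
      simp
    · have hpos : (0 : ℝ) < ((m : ℝ) + k) ^ B.card := by positivity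
      rw [div_pow, div_mul_eq_mul_div, le_div_iff₀ hpos]
      exact_mod_cast choose_sub_mul_pow_le (Nat.le_add_right m k) hB
  · have : {s : AttachmentChoice m k | B ⊆ s.1} = ∅ := by
      refine Set.eq_empty_of_forall_notMem fun s hs => hB ?_
      exact (Finset.card_le_card hs).trans_eq s.2
    rw [this]
    simp

theorem choiceMeasure_notMem_le {m k : ℕ} (hm : 0 < m) (i : Fin (m + k)) :
    choiceMeasure m k {s | i ∉ s.1} ≤ ENNReal.ofReal (((m : ℝ) + k - 1) / (m + k)) := by
  refine choiceMeasure_le (fun s => s.1) (Finset.powersetCard m (Finset.univ.erase i)) ?_ ?_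
    (c := (m + k - 1).choose m) ?_ ?_
  · intro s hs
    rw [Finset.mem_coe, Finset.mem_powersetCard]
    refine ⟨fun j hj => Finset.mem_erase.2 ⟨?_, Finset.mem_univ _⟩, s.2⟩
    rintro rfl
    exact hs hj
  · intro s _ s' _ h
    exact Subtype.ext h
  · rw [Finset.card_powersetCard, Finset.card_erase_of_mem (Finset.mem_univ _)]
    simp
  · obtain ⟨n, hn⟩ : ∃ n, m + k = n + 1 := ⟨m + k - 1, by omega⟩
    have h1 := Nat.choose_mul_succ_eq n m
    have h2 : n + 1 - m ≤ n := by omega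
    have h3 : n.choose m * (n + 1) ≤ (n + 1).choose m * n :=
      h1.le.trans (Nat.mul_le_mul_left _ h2)
    have hn' : (m : ℝ) + k = n + 1 := by exact_mod_cast hn
    rw [hn', hn, div_mul_eq_mul_div, le_div_iff₀ (by positivity)]
    have h4 : ((n.choose m : ℝ)) * (n + 1) ≤ (n + 1).choose m * n := by exact_mod_cast h3
    simpa [mul_comm] using h4

end Choice

/-! ### The attachment graph on all vertices -/

section AttachmentGraph

variable {m : ℕ} {ω : ∀ k, AttachmentChoice m k} {u v k : ℕ}

/-- The graph on all of `ℕ` that is determined by the choices. -/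
def attachmentGraph {m : ℕ} (ω : ∀ k, AttachmentChoice m k) : SimpleGraph ℕ :=
  SimpleGraph.fromRel fun v u => AttachesTo ω v u

theorem AttachesTo.lt (h : AttachesTo ω v u) : u < v := by
  rcases h with h | ⟨k, rfl, i, _, rfl⟩
  · exact h.1
  · exact i.2

theorem attachesTo_add_iff : AttachesTo ω (m + k) u ↔ ∃ i ∈ (ω k).1, u = (i : ℕ) := by
  constructor
  · rintro (h | ⟨k', hk, h⟩)
    · omega
    · obtain rfl : k = k' := by omega
      exact h
  · exact fun h => Or.inr ⟨k, rfl, h⟩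

theorem attachmentGraph_adj_iff (h : u < v) : (attachmentGraph ω).Adj v u ↔ AttachesTo ω v u := by
  rw [attachmentGraph, SimpleGraph.fromRel_adj]
  exact ⟨fun h' => h'.2.resolve_right fun h'' => by have := h''.lt; omega,
    fun h' => ⟨h.ne', Or.inl h'⟩⟩

theorem initialGraph_attachmentGraph (n : ℕ) :
    initialGraph (attachmentGraph ω) n = uniformAttachmentGraph m n ω := by
  ext a b
  simp [initialGraph, attachmentGraph, uniformAttachmentGraph, Fin.val_inj]

theorem exists_backNeighbours (hv : m ≤ v) :
    ∃ Y ⊆ Finset.range v, Y.card = m ∧ ∀ y ∈ Y, (attachmentGraph ω).Adj v y := by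
  obtain ⟨k, rfl⟩ := Nat.exists_eq_add_of_le hv
  refine ⟨(ω k).1.map Fin.valEmbedding, ?_, ?_, ?_⟩
  · intro y hy
    obtain ⟨i, _, rfl⟩ := Finset.mem_map.1 hy
    exact Finset.mem_range.2 i.2
  · rw [Finset.card_map, (ω k).2]
  · intro y hy
    obtain ⟨i, hi, rfl⟩ := Finset.mem_map.1 hy
    exact (attachmentGraph_adj_iff i.2).2 (attachesTo_add_iff.2 ⟨i, hi, rfl⟩)

end AttachmentGraph

instance (m : ℕ) : IsProbabilityMeasure (attachmentMeasure m) :=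
  inferInstanceAs (IsProbabilityMeasure (Measure.infinitePi fun k => choiceMeasure m k))

theorem attachmentMeasure_pi (m : ℕ) (I : Finset ℕ) (t : ∀ k, Set (AttachmentChoice m k)) :
    attachmentMeasure m (Set.pi I t) = ∏ k ∈ I, choiceMeasure m k (t k) :=
  Measure.infinitePi_pi (μ := fun k => choiceMeasure m k) fun _ _ => trivial

/-! ### Tight sets are almost surely bounded -/

section TightBounded

variable {m : ℕ}

theorem attachmentMeasure_backEdges_le (hm : 0 < m) (S : Finset ℕ) (b : ℕ → Finset ℕ)
    (hb : ∀ v ∈ S, ∀ u ∈ b v, u < v) :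
    attachmentMeasure m {ω | ∀ v ∈ S, ∀ u ∈ b v, AttachesTo ω v u} ≤
      ENNReal.ofReal (∏ v ∈ S, (2 * m / ((v : ℝ) + 1)) ^ (b v).card) := by
  classical
  set I : Finset ℕ := S.preimage (m + ·) (add_right_injective m).injOn with hI
  set t : ∀ k, Set (AttachmentChoice m k) := fun k =>
    {s | (Finset.univ.filter fun i : Fin (m + k) => (i : ℕ) ∈ b (m + k)) ⊆ s.1} with ht
  have hcard : ∀ k ∈ I,
      (Finset.univ.filter fun i : Fin (m + k) => (i : ℕ) ∈ b (m + k)).card = (b (m + k)).card := by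
    intro k hk
    rw [← Finset.card_map Fin.valEmbedding]
    congr 1
    ext u
    simp only [Finset.mem_map, Finset.mem_filter, Finset.mem_univ, true_and,
      Fin.valEmbedding_apply]
    constructor
    · rintro ⟨i, hi, rfl⟩
      exact hi
    · exact fun hu => ⟨⟨u, hb _ (Finset.mem_preimage.1 hk) u hu⟩, hu, rfl⟩
  have hsub : {ω : ∀ k, AttachmentChoice m k | ∀ v ∈ S, ∀ u ∈ b v, AttachesTo ω v u} ⊆
      Set.pi I t := by
    intro ω hω k hk i hi
    have hk' : m + k ∈ S := Finset.mem_preimage.1 hk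
    obtain ⟨j, hj, hij⟩ := attachesTo_add_iff.1 (hω _ hk' i (Finset.mem_filter.1 hi).2)
    rwa [Fin.ext hij]
  refine (measure_mono hsub).trans ?_
  rw [attachmentMeasure_pi]
  calc ∏ k ∈ I, choiceMeasure m k (t k)
      ≤ ∏ k ∈ I, ENNReal.ofReal ((2 * m / (((m + k : ℕ) : ℝ) + 1)) ^ (b (m + k)).card) := by
        refine Finset.prod_le_prod' fun k hk => (choiceMeasure_superset_le hm _).trans ?_
        rw [hcard k hk]
        refine ENNReal.ofReal_le_ofReal (pow_le_pow_left₀ (by positivity) ?_ _)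
        have hm' : (1 : ℝ) ≤ m := by exact_mod_cast hm
        have hk' : (0 : ℝ) ≤ k := by positivity
        rw [div_le_div_iff₀ (by positivity) (by positivity)]
        push_cast
        nlinarith
    _ = ENNReal.ofReal (∏ k ∈ I, (2 * m / (((m + k : ℕ) : ℝ) + 1)) ^ (b (m + k)).card) :=
        (ENNReal.ofReal_prod_of_nonneg fun k _ => by positivity).symm
    _ = ENNReal.ofReal (∏ v ∈ I.image (m + ·), (2 * m / ((v : ℝ) + 1)) ^ (b v).card) := by
        rw [Finset.prod_image (by simp [Set.InjOn])]
    _ ≤ _ := by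
        refine ENNReal.ofReal_le_ofReal ?_
        have hIS : I.image (m + ·) ⊆ S := by
          intro v hv
          obtain ⟨k, hk, rfl⟩ := Finset.mem_image.1 hv
          exact Finset.mem_preimage.1 hk
        rw [← Finset.prod_sdiff hIS]
        -- Vertices below `m` make no random choice; their factors are at least 1, so they may be
        -- included. The 2 in `2 * m` also pays for replacing `v` by `v + 1` in the denominator.
        refine le_mul_of_one_le_left (Finset.prod_nonneg fun v _ => by positivity) ?_
        refine Finset.one_le_prod fun v hv => one_le_pow₀ ?_
        rw [Finset.mem_sdiff] at hv
        have hvm : v < m := by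
          by_contra hlt
          refine hv.2 (Finset.mem_image.2 ⟨v - m, ?_, Nat.add_sub_of_le (by omega)⟩)
          rw [hI, Finset.mem_preimage]
          exact (Nat.add_sub_of_le (not_lt.1 hlt)).symm ▸ hv.1
        rw [le_div_iff₀ (by positivity)]
        have : (v : ℝ) + 1 ≤ m := by exact_mod_cast hvm
        have : (0 : ℝ) ≤ m := by positivity
        linarith

/-- Union bound over the possible sets of back edges of `S`, of which there are at most `2 ^ (B * (B
+ N))`. -/
theorem attachmentMeasure_tight_le (hm : 0 < m) (N : ℕ) {S : Finset ℕ} {B : ℕ} (hne : S.Nonempty)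
    (hB : S.card ≤ B) :
    attachmentMeasure m {ω | Tight (attachmentGraph ω) (Finset.range N) S} ≤
      ENNReal.ofReal (2 ^ (B * (B + N)) * (2 * m) ^ ((B + N) * B) *
        ∏ v ∈ S, ((v : ℝ) + 1) ^ (-(1 + 1 / (B : ℝ)))) := by
  classical
  set T := S ∪ Finset.range N with hT
  have hTc : T.card ≤ B + N := (Finset.card_union_le _ _).trans (by simpa using hB)
  set b : Finset (ℕ × ℕ) → ℕ → Finset ℕ := fun P v => T.filter fun u => (v, u) ∈ P with hb
  set Q := (S ×ˢ T).powerset.filter fun P => (∀ p ∈ P, p.2 < p.1) ∧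
    ∀ t ∈ S, (S.filter (t ≤ ·)).card + 1 ≤ ∑ v ∈ S.filter (t ≤ ·), (b P v).card with hQ
  have hsub : {ω : ∀ k, AttachmentChoice m k | Tight (attachmentGraph ω) (Finset.range N) S} ⊆
      ⋃ P ∈ Q, {ω | ∀ v ∈ S, ∀ u ∈ b P v, AttachesTo ω v u} := by
    intro ω hω
    rw [Set.mem_iUnion₂]
    have hbP : ∀ v ∈ S, b ((S ×ˢ T).filter fun p => p.2 < p.1 ∧ (attachmentGraph ω).Adj p.1 p.2) v =
        T.filter fun w => w < v ∧ (attachmentGraph ω).Adj v w := by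
      intro v hv
      ext u
      simp only [hb, Finset.mem_filter, Finset.mem_product]
      tauto
    refine ⟨(S ×ˢ T).filter fun p => p.2 < p.1 ∧ (attachmentGraph ω).Adj p.1 p.2, ?_, ?_⟩
    · refine Finset.mem_filter.2 ⟨Finset.mem_powerset.2 (Finset.filter_subset _ _),
        fun p hp => (Finset.mem_filter.1 hp).2.1, fun t ht => ?_⟩
      rw [Finset.sum_congr rfl fun v hv => by rw [hbP v (Finset.mem_filter.1 hv).1]]
      exact card_tight_filter_lt_sum hω ht
    · intro v hv u hu
      rw [hbP v hv, Finset.mem_filter] at hu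
      exact (attachmentGraph_adj_iff hu.2.1).1 hu.2.2
  have hterm : ∀ P ∈ Q, attachmentMeasure m {ω | ∀ v ∈ S, ∀ u ∈ b P v, AttachesTo ω v u} ≤
      ENNReal.ofReal ((2 * m) ^ ((B + N) * B) *
        ∏ v ∈ S, ((v : ℝ) + 1) ^ (-(1 + 1 / (B : ℝ)))) := by
    intro P hP
    obtain ⟨_, hlt, hsuf⟩ := Finset.mem_filter.1 hP
    refine (attachmentMeasure_backEdges_le hm S (b P) fun v _ u hu =>
      hlt _ (Finset.mem_filter.1 hu).2).trans (ENNReal.ofReal_le_ofReal ?_)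
    have hm' : (1 : ℝ) ≤ 2 * m := by
      have : (1 : ℝ) ≤ m := by exact_mod_cast hm
      linarith
    calc ∏ v ∈ S, (2 * m / ((v : ℝ) + 1)) ^ (b P v).card
        = (∏ v ∈ S, (2 * (m : ℝ)) ^ (b P v).card) * ∏ v ∈ S, (((v : ℝ) + 1) ^ (b P v).card)⁻¹ := by
          rw [← Finset.prod_mul_distrib]
          exact Finset.prod_congr rfl fun v _ => by rw [div_pow, div_eq_mul_inv]
      _ ≤ _ := by
          refine mul_le_mul ?_ (prod_inv_pow_le hne hB hsuf)
            (Finset.prod_nonneg fun v _ => by positivity) (by positivity)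
          rw [Finset.prod_pow_eq_pow_sum]
          refine pow_le_pow_right₀ hm' ?_
          calc ∑ v ∈ S, (b P v).card ≤ ∑ _v ∈ S, (B + N) := Finset.sum_le_sum fun v _ =>
                (Finset.card_le_card (Finset.filter_subset _ _)).trans hTc
            _ = S.card * (B + N) := by rw [Finset.sum_const, smul_eq_mul]
            _ ≤ (B + N) * B := by rw [mul_comm]; exact Nat.mul_le_mul_left _ hB
  have hcard : Q.card ≤ 2 ^ (B * (B + N)) := by
    refine (Finset.card_le_card (Finset.filter_subset _ _)).trans ?_
    rw [Finset.card_powerset, Finset.card_product]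
    exact Nat.pow_le_pow_right (by norm_num) (Nat.mul_le_mul hB hTc)
  refine (measure_mono hsub).trans ((measure_biUnion_finset_le _ _).trans
    ((Finset.sum_le_card_nsmul _ _ _ hterm).trans ?_))
  rw [nsmul_eq_mul, ← ENNReal.ofReal_natCast, ← ENNReal.ofReal_mul (by positivity), mul_assoc]
  refine ENNReal.ofReal_le_ofReal (mul_le_mul_of_nonneg_right (by exact_mod_cast hcard) ?_)
  exact mul_nonneg (by positivity) (Finset.prod_nonneg fun v _ => by positivity)

theorem ae_tightBounded (hm : 0 < m) :
    ∀ᵐ ω ∂attachmentMeasure m, TightBounded (attachmentGraph ω) := by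
  simp only [TightBounded]
  refine ae_all_iff.2 fun N => ae_all_iff.2 fun B => ?_
  rcases B.eq_zero_or_pos with rfl | hB
  · refine Eventually.of_forall fun ω => ⟨0, fun S _ hS => ?_⟩
    rw [Finset.card_eq_zero.1 (Nat.le_zero.1 hS)]
    exact Finset.empty_subset _
  set f : Finset ℕ → ℝ := fun S => 2 ^ (B * (B + N)) * (2 * m) ^ ((B + N) * B) *
    ∏ v ∈ S, ((v : ℝ) + 1) ^ (-(1 + 1 / (B : ℝ))) with hf
  have hsum : Summable f := by
    -- Products over finite sets of a summable nonnegative sequence are summable; the exponent `1 +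
    -- 1 / B` exceeds 1.
    refine Summable.mul_left _ (summable_finsetProd_of_summable_nonneg (fun v => by positivity) ?_)
    have h1 : Summable fun v : ℕ => (v : ℝ) ^ (-(1 + 1 / (B : ℝ))) := by
      rw [Real.summable_nat_rpow]
      have : 0 < 1 / (B : ℝ) := by positivity
      linarith
    simpa using (summable_nat_add_iff 1).2 h1
  have hle : ∀ S : Finset ℕ, attachmentMeasure m {ω | S.Nonempty ∧ S.card ≤ B ∧
      Tight (attachmentGraph ω) (Finset.range N) S} ≤ ENNReal.ofReal (f S) := by
    intro S
    by_cases h : S.Nonempty ∧ S.card ≤ B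
    · exact (measure_mono fun ω hω => hω.2.2).trans (attachmentMeasure_tight_le hm N h.1 h.2)
    · refine (measure_mono fun ω hω => h ⟨hω.1, hω.2.1⟩).trans (measure_empty.trans_le zero_le)
  -- Borel–Cantelli: almost surely only finitely many nonempty sets of size at most `B` are tight.
  have hfin := ae_finite_setOfPred_mem (ne_top_of_le_ne_top hsum.tsum_ofReal_ne_top
    (ENNReal.tsum_le_tsum hle))
  filter_upwards [hfin] with ω hω
  refine ⟨hω.toFinset.sup fun S => S.sup (· + 1), fun S hS hSB v hv => Finset.mem_range.2 ?_⟩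
  have hmem : S ∈ hω.toFinset := by
    rw [Set.Finite.mem_toFinset]
    exact ⟨⟨v, hv⟩, hSB, hS⟩
  calc v < v + 1 := v.lt_succ_self
    _ ≤ S.sup (· + 1) := Finset.le_sup (f := (· + 1)) hv
    _ ≤ _ := Finset.le_sup (f := fun S : Finset ℕ => S.sup (· + 1)) hmem

end TightBounded

/-! ### Almost surely all degrees are infinite -/

section Degrees

variable {m : ℕ}

/-- The product nearly telescopes. It tends to 0, so a vertex is almost surely chosen again after
any time. -/
theorem prod_ofReal_sub_one_div_le (hm : 0 < m) (K j : ℕ) :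
    ∏ k ∈ Finset.Ico K (K + j), ENNReal.ofReal (((m : ℝ) + k - 1) / (m + k)) ≤
      ENNReal.ofReal (((m : ℝ) + K) / (m + K + j)) := by
  have hm' : (1 : ℝ) ≤ m := by exact_mod_cast hm
  induction j with
  | zero =>
    have : ((m : ℝ) + K) / (m + K) = 1 := div_self (by positivity)
    simp [this]
  | succ j ih =>
    rw [← add_assoc, Finset.prod_Ico_succ_top (by omega)]
    refine (mul_le_mul_left ih _).trans ?_
    rw [← ENNReal.ofReal_mul (by positivity)]
    refine ENNReal.ofReal_le_ofReal ?_
    have hK : (0 : ℝ) ≤ K := by positivity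
    have hj : (0 : ℝ) ≤ j := by positivity
    push_cast
    rw [div_mul_div_comm, div_le_div_iff₀ (by positivity) (by positivity)]
    have : 0 ≤ (m : ℝ) + K := by positivity
    nlinarith [mul_nonneg this hj]

theorem attachmentMeasure_forall_notMem (hm : 0 < m) {u K : ℕ} (hK : u < m + K) :
    attachmentMeasure m {ω | ∀ k ≥ K, ¬ AttachesTo ω (m + k) u} = 0 := by
  have hle : ∀ j : ℕ, attachmentMeasure m {ω | ∀ k ≥ K, ¬ AttachesTo ω (m + k) u} ≤
      ENNReal.ofReal (((m : ℝ) + K) / (m + K + j)) := by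
    intro j
    set t : ∀ k, Set (AttachmentChoice m k) := fun k => {s | ∀ i ∈ s.1, u ≠ (i : ℕ)} with ht
    have hsub : {ω : ∀ k, AttachmentChoice m k | ∀ k ≥ K, ¬ AttachesTo ω (m + k) u} ⊆
        Set.pi (Finset.Ico K (K + j)) t := by
      intro ω hω k hk i hi h
      exact hω k (by simpa using (Finset.mem_Ico.1 hk).1) (attachesTo_add_iff.2 ⟨i, hi, h⟩)
    refine (measure_mono hsub).trans ?_
    rw [attachmentMeasure_pi]
    refine (Finset.prod_le_prod' fun k hk => ?_).trans (prod_ofReal_sub_one_div_le hm K j)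
    have hk : K ≤ k := (Finset.mem_Ico.1 hk).1
    refine (measure_mono fun s hs => ?_).trans
      (choiceMeasure_notMem_le hm (⟨u, by omega⟩ : Fin (m + k)))
    exact fun h => hs _ h rfl
  have hlim : Tendsto (fun j : ℕ => ENNReal.ofReal (((m : ℝ) + K) / (m + K + j))) atTop (𝓝 0) := by
    rw [← ENNReal.ofReal_zero]
    refine ENNReal.tendsto_ofReal (Tendsto.div_atTop tendsto_const_nhds ?_)
    exact tendsto_atTop_add_const_left _ _ tendsto_natCast_atTop_atTop
  exact le_antisymm (ge_of_tendsto' hlim hle) zero_le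

theorem ae_infinite_neighbours (hm : 0 < m) :
    ∀ᵐ ω ∂attachmentMeasure m, ∀ v, {w | (attachmentGraph ω).Adj v w}.Infinite := by
  refine ae_all_iff.2 fun v => ?_
  have h : ∀ᵐ ω ∂attachmentMeasure m, ∀ K, v < m + K → ∃ k ≥ K, AttachesTo ω (m + k) v := by
    refine ae_all_iff.2 fun K => ?_
    by_cases hK : v < m + K
    · have := measure_eq_zero_iff_ae_notMem.1 (attachmentMeasure_forall_notMem hm hK)
      filter_upwards [this] with ω hω _
      by_contra! hcon
      exact hω hcon
    · exact Eventually.of_forall fun ω h => absurd h hK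
  filter_upwards [h] with ω hω
  refine Set.infinite_of_not_bddAbove ?_
  rintro ⟨M, hM⟩
  obtain ⟨k, hk, hadj⟩ := hω (M + v + 1) (by omega)
  have := hM (show m + k ∈ _ from ((attachmentGraph_adj_iff hadj.lt).2 hadj).symm)
  omega

end Degrees

/-! ### Convergence of the probabilities -/

theorem uniformAttachmentGraph_congr {m n : ℕ} {ω ω' : ∀ k, AttachmentChoice m k}
    (h : ∀ k < n, ω k = ω' k) : uniformAttachmentGraph m n ω = uniformAttachmentGraph m n ω' := by
  have key : ∀ v < n, ∀ u, AttachesTo ω v u ↔ AttachesTo ω' v u := by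
    intro v hv u
    refine or_congr_right (exists_congr fun k => and_congr_right fun hk => ?_)
    rw [h k (by omega)]
  ext a b
  simp only [uniformAttachmentGraph, SimpleGraph.fromRel_adj, key a a.2, key b b.2]

theorem measurableSet_models (m n : ℕ) (φ : GraphFormula) :
    MeasurableSet {ω | (uniformAttachmentGraph m n ω).Models φ} := by
  set r : (∀ k, AttachmentChoice m k) → ∀ k : Fin n, AttachmentChoice m k := fun ω k => ω k with hr
  have hmeas : Measurable r := measurable_pi_lambda _ fun k => measurable_pi_apply _
  -- The event depends only on the first `n` choices, which take finitely many values.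
  have : {ω | (uniformAttachmentGraph m n ω).Models φ} =
      r ⁻¹' (r '' {ω | (uniformAttachmentGraph m n ω).Models φ}) := by
    refine Set.Subset.antisymm (Set.subset_preimage_image _ _) ?_
    rintro ω ⟨ω', hω', h⟩
    change (uniformAttachmentGraph m n ω).Models φ
    rwa [uniformAttachmentGraph_congr fun k hk => (congrFun h ⟨k, hk⟩).symm]
  rw [this]
  exact hmeas (Set.toFinite _).measurableSet

theorem theorem1 (m : ℕ) (φ : GraphFormula) (hφ : φ.IsSentence) (hvars : φ.vars.card + 2 ≤ m) :
    ∃ p : ℝ, Tendsto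
      (fun n : ℕ => (attachmentMeasure m).real {ω | (uniformAttachmentGraph m n ω).Models φ})
      atTop (𝓝 p) := by
  have hm : 0 < m := by omega
  set E : ℕ → Set (∀ k, AttachmentChoice m k) := fun n =>
    {ω | (uniformAttachmentGraph m n ω).Models φ} with hE
  set A : Set (∀ k, AttachmentChoice m k) := liminf E atTop with hA
  have hEm : ∀ n, MeasurableSet (E n) := fun n => measurableSet_models m n φ
  have hAm : MeasurableSet A := MeasurableSet.measurableSet_liminf hEm
  -- As the truth value stabilises almost surely, the indicators of the events converge almost
  -- surely to that of their lower limit `A`, whose measure is the limit sought.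
  have hlim : ∀ᵐ ω ∂attachmentMeasure m, ∀ᶠ n in atTop, ω ∈ E n ↔ ω ∈ A := by
    filter_upwards [ae_tightBounded hm, ae_infinite_neighbours hm] with ω h1 h2
    obtain ⟨n₀, hn₀⟩ := eventually_models_iff h1 h2 (fun v hv => exists_backNeighbours hv) hφ hvars
    simp only [initialGraph_attachmentGraph] at hn₀
    have hωA : ω ∈ A ↔ ω ∈ E n₀ := by
      rw [hA, Filter.mem_liminf_iff_eventually_mem]
      constructor
      · intro h
        obtain ⟨n, hn, hn'⟩ := (h.and (eventually_ge_atTop n₀)).exists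
        exact (hn₀ n hn').1 hn
      · intro h
        filter_upwards [eventually_ge_atTop n₀] with n hn
        exact (hn₀ n hn).2 h
    filter_upwards [eventually_ge_atTop n₀] with n hn
    exact (hn₀ n hn).trans hωA.symm
  exact ⟨(attachmentMeasure m).real A, (ENNReal.tendsto_toReal (measure_ne_top _ _)).comp
    (tendsto_measure_of_ae_tendsto_indicator_of_isFiniteMeasure atTop hAm hEm hlim)⟩
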